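/- Setting. Let $K$ be an abstract simplicial complex on a countable vertex set $V$ (a downward closed family of finite subsets of $V$ containing all singletons). Let $\Sigma$ be the set of its nonempty simplices, together with the empty simplex if (and only if) $V$ is finite, and let every simplex have weight $m\equiv 1$. Write $\tau\prec\sigma$ (or $\sigma\succ\tau$) if $\tau\subset\sigma$ and $|\sigma\setminus\tau|=1$, and $\dim\sigma=|\sigma|-1$. Assume that $\Sigma$ is locally finite (every $\tau\in\Sigma$ has only finitely many $\sigma\succ\tau$; for $m\equiv1$ this is local summability of the weight), connected (its 1-skeleton is a connected graph) and finite dimensional ($\sup_\sigma\dim\sigma<\infty$). Let $\delta:\mathbb R^\Sigma\to\mathbb R^\Sigma$ be a coboundary operator, i.e. a linear map with $\theta(\tau,\sigma):=\delta 1_\tau(\sigma)\in\{-1,0,1\}$, $\theta(\tau,\sigma)\neq0$ iff $\tau\prec\sigma$, $\delta\omega(\sigma)=\sum_{\tau\prec\sigma}\omega(\tau)\theta(\tau,\sigma)$, and $\delta\delta=0$. Let $\partial\omega(\rho)=\sum_{\tau\succ\rho}\omega(\tau)\theta(\rho,\tau)$. Put $A^+=\delta$, $A^-=\partial$, $A^H=\delta+\partial$,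 and for $\bullet\in\{+,-,H\}$ let $\mathcal Q^\bullet(\omega,\eta)=\sum_\Sigma (A^\bullet\omega)(A^\bullet\eta)$ and $\mathcal Q^\bullet(\omega)=\mathcal Q^\bullet(\omega,\omega)$. Let $\ell^2=\ell^2(\Sigma)$ be the real Hilbert space of square summable functions and $F^c\subseteq\ell^2$ the space of finitely supported functions. Let $Q^\bullet_N$ be the restriction of $\mathcal Q^\bullet$ to $\{\omega\in\ell^2: \mathcal Q^\bullet(\omega)<\infty\}$, and $Q^\bullet_D$ its restriction to the closure of $F^c$ with respect to the norm $(\mathcal Q^\bullet(\omega)+\|\omega\|^2)^{1/2}$. A Laplacian $\Delta^\bullet$ is the positive self-adjoint operator on $\ell^2$ associated with a closed quadratic form $Q$ with $Q^\bullet_D\subseteq Q\subseteq Q^\bullet_N$: its domain is the set of $\eta\in D(Q)$ for which there is $h\in\ell^2$ with $Q(\omega,\eta)=\langle\omega,h\rangle$ for all $\omega\in D(Q)$, and $\Delta^\bullet\eta=h$. Let $\Delta^\bullet_c$ be the restriction of $\Delta^\bullet$ to $F^c$. For $v\in V$ let $\deg(v)$ be the number of edges (1-simplices) containing $v$, and let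 $$\rho(v,w)=\inf_{v=v_0\sim\dots\sim v_n=w}\ \sum_{k=1}^n\max\{\deg(v_k),\deg(v_{k-1})\}^{-1/2},$$ where $\sim$ is adjacency in the 1-skeleton. For $\tau,\tau'\in\Sigma$ let $b^+(\tau,\tau')=1$ if $\tau\cup\tau'\in\Sigma$ and $\tau,\tau'\prec\tau\cup\tau'$, let $b^-(\tau,\tau')=1$ if $\tau\cap\tau'\in\Sigma$ and $\tau\cap\tau'\prec\tau,\tau'$, and let both be $0$ otherwise. Let $b^H=|b^--b^+|$. The Forman curvature is $$c^H(\tau)=\#\{\rho\in\Sigma:\rho\prec\tau\}+\#\{\sigma\in\Sigma:\sigma\succ\tau\}-\sum_{\tau'\in\Sigma}b^H(\tau,\tau').$$ Theorem (Combinatorial weight). For every $\bullet\in\{+,-,H\}$ and every Laplacian $\Delta^\bullet$: (a) $\Delta^\bullet$ is bounded (an everywhere defined bounded operator on $\ell^2$) if and only if $\deg$ is bounded. (b) $F^c\subseteq D(\Delta^\bullet)$. (c) If the Forman curvature $c^H$ is bounded from below, then $\Delta^\bullet_c$ is essentially self-adjoint. (d) If $(V,\rho)$ is a complete metric space, then $\Delta^\bullet_c$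 is essentially self-adjoint. -/

import Mathlib

open scoped InnerProductSpace Topology

noncomputable section

namespace AbstractSimplicialComplex

variable {V : Type*} (K : AbstractSimplicialComplex V)

/-! ### Simplices, faces, local finiteness -/

/-- The set `Σ` of simplices, for the weight `m ≡ 1`: all nonempty faces of the complex, together
with the empty simplex exactly when the vertex set has finite total weight, i.e. is finite. -/
def Simplex : Type _ := {σ : Finset V // σ ∈ K.faces ∨ (σ = ∅ ∧ Finite V)}

variable {K}

/-- `τ ≺ σ`: `τ` is a face of `σ` (and `σ` a coface of `τ`), i.e. `τ ⊆ σ` and `σ` has exactly one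
vertex more than `τ`. -/
def IsFace (τ σ : K.Simplex) : Prop := τ.1 ⊆ σ.1 ∧ σ.1.card = τ.1.card + 1

theorem finite_faces (σ : K.Simplex) : {τ : K.Simplex | IsFace τ σ}.Finite := by
  refine Set.Finite.of_finite_image (f := fun τ : K.Simplex => τ.1) ?_
    (fun a _ b _ h => Subtype.ext h)
  refine (σ.1.powerset.finite_toSet).subset ?_
  rintro _ ⟨τ, hτ, rfl⟩
  simpa using hτ.1

variable (K)

/-- Every simplex has only finitely many cofaces. For the weight `m ≡ 1` this is the same as
local summability of the weight, `∑_{σ ≻ τ} m(σ) < ∞` for every simplex `τ`. -/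
class LocallyFinite : Prop where
  finite_cofaces : ∀ τ : K.Simplex, {σ : K.Simplex | IsFace τ σ}.Finite

/-- The dimensions `card σ - 1` of the simplices are bounded. -/
def FiniteDimensional : Prop := ∃ N : ℕ, ∀ σ ∈ K.faces, σ.card ≤ N + 1

open Classical in
/-- The 1-skeleton: two distinct vertices are adjacent if they span a 1-simplex. -/
def oneSkeleton : SimpleGraph V where
  Adj v w := v ≠ w ∧ ({v, w} : Finset V) ∈ K.faces
  symm := ⟨fun v w h => ⟨h.1.symm, by rw [Finset.pair_comm]; exact h.2⟩⟩
  loopless := ⟨fun _ h => h.1 rfl⟩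

/-! ### Coboundary and boundary operators -/

open Classical in
/-- A coboundary operator: a linear map `δ` on all real functions on `Σ` with
`θ(τ, σ) = δ 1_τ (σ) ∈ {-1, 0, 1}`, nonzero iff `τ ≺ σ`, acting by
`δ ω (σ) = ∑_{τ ≺ σ} ω(τ) θ(τ, σ)`, and satisfying `δ δ = 0`. -/
structure Coboundary where
  toLin : (K.Simplex → ℝ) →ₗ[ℝ] (K.Simplex → ℝ)
  sign_mem : ∀ τ σ, toLin (Pi.single τ 1) σ ∈ ({-1, 0, 1} : Set ℝ)
  sign_ne_zero_iff : ∀ τ σ, toLin (Pi.single τ 1) σ ≠ 0 ↔ IsFace τ σ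
  apply_eq : ∀ ω σ,
    toLin ω σ = ∑ τ ∈ (finite_faces σ).toFinset, ω τ * toLin (Pi.single τ 1) σ
  comp_self : toLin ∘ₗ toLin = 0

variable {K}

open Classical in
/-- The signs `θ(τ, σ) = δ 1_τ (σ)`. -/
def Coboundary.sign (δ : K.Coboundary) (τ σ : K.Simplex) : ℝ := δ.toLin (Pi.single τ 1) σ

/-- The boundary operator for `m ≡ 1`: `∂ ω (ρ) = ∑_{τ ≻ ρ} ω(τ) θ(ρ, τ)`. By local finiteness
the sum is finite and `∂` is defined on all functions. -/
def Coboundary.boundary [hK : K.LocallyFinite] (δ : K.Coboundary) :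
    (K.Simplex → ℝ) →ₗ[ℝ] (K.Simplex → ℝ) where
  toFun ω ρ := ∑ τ ∈ (hK.finite_cofaces ρ).toFinset, ω τ * δ.sign ρ τ
  map_add' ω η := by
    funext ρ
    simp only [Pi.add_apply, add_mul, Finset.sum_add_distrib]
  map_smul' c ω := by
    funext ρ
    simp only [Pi.smul_apply, smul_eq_mul, mul_assoc, Finset.mul_sum, RingHom.id_apply]

variable (K)

/-- The real Hilbert space `ℓ²(Σ, m)` for `m ≡ 1`. -/
abbrev L2 : Type _ := lp (fun _ : K.Simplex => ℝ) 2

/-- The finitely supported functions `F^c`, as a subspace of `ℓ²`. -/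
def finSupp : Submodule ℝ K.L2 where
  carrier := {ω | (Function.support (ω : K.Simplex → ℝ)).Finite}
  zero_mem' := by
    change (Function.support (0 : K.Simplex → ℝ)).Finite
    rw [Function.support_zero]
    exact Set.finite_empty
  add_mem' {ω η} hω hη := by
    refine (hω.union hη).subset ?_
    rw [lp.coeFn_add]
    exact Function.support_add _ _
  smul_mem' c ω hω := by
    refine Set.Finite.subset hω ?_
    rw [lp.coeFn_smul]
    exact Function.support_const_smul_subset c _

/-! ### Quadratic forms and Laplacians -/

/-- The three types of Laplacians: up (`+`), down (`-`) and Hodge (`H`). -/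
inductive Kind
  | up
  | down
  | hodge

variable {K}
variable [K.LocallyFinite] (δ : K.Coboundary)

/-- The first order operator whose square norm is the quadratic form: `δ`, `∂`, `δ + ∂`
for the kinds `+`, `-`, `H`. -/
def Coboundary.firstOrder (δ : K.Coboundary) : Kind → (K.Simplex → ℝ) →ₗ[ℝ] (K.Simplex → ℝ)
  | .up => δ.toLin
  | .down => δ.boundary
  | .hodge => δ.toLin + δ.boundary

/-- The (polarized) form `𝒬(ω, η) = ∑_Σ (A ω) (A η)` with `A = δ`, `∂`, `δ + ∂`. It is used only
for `ω`, `η` with square summable `A ω`, `A η`. -/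
def Coboundary.form (k : Kind) (ω η : K.Simplex → ℝ) : ℝ :=
  ∑' σ, δ.firstOrder k ω σ * δ.firstOrder k η σ

/-- The domain `D(Q_N)` of the Neumann form: all `ω ∈ ℓ²` of finite energy `𝒬(ω) < ∞`. -/
def Coboundary.neumannDomain (k : Kind) : Submodule ℝ K.L2 where
  carrier := {ω | Memℓp (δ.firstOrder k (ω : K.Simplex → ℝ)) 2}
  zero_mem' := by
    simp only [Set.mem_ofPred_eq, lp.coeFn_zero, map_zero]
    exact zero_memℓp
  add_mem' {ω η} hω hη := by
    simp only [Set.mem_ofPred_eq, lp.coeFn_add, map_add] at *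
    exact hω.add hη
  smul_mem' c ω hω := by
    simp only [Set.mem_ofPred_eq, lp.coeFn_smul, map_smul] at *
    exact hω.const_smul c

/-- The domain `D(Q_D)` of the Dirichlet form: the closure of `F^c` in `D(Q_N)` with respect to
the form norm `(𝒬(ω) + ‖ω‖²)^{1/2}`. -/
def Coboundary.dirichletDomain (k : Kind) : Set K.L2 :=
  {ω | ω ∈ δ.neumannDomain k ∧ ∀ ε > (0 : ℝ), ∃ φ ∈ K.finSupp,
    δ.form k (ω - φ : K.L2) (ω - φ : K.L2) + ‖ω - φ‖ ^ 2 < ε}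

/-- A closed quadratic form `Q` with `Q_D ⊆ Q ⊆ Q_N`. Such a form is the restriction of `𝒬` to its
domain, so it is given by this domain. -/
structure Coboundary.ClosedForm (k : Kind) where
  dom : Submodule ℝ K.L2
  dirichlet_le : δ.dirichletDomain k ⊆ dom
  le_neumann : dom ≤ δ.neumannDomain k
  closed : ∀ (u : ℕ → K.L2) (ω : K.L2), (∀ n, u n ∈ dom) →
    Filter.Tendsto u Filter.atTop (𝓝 ω) →
    (∀ ε > (0 : ℝ), ∃ N, ∀ m ≥ N, ∀ n ≥ N,
      δ.form k (u m - u n : K.L2) (u m - u n : K.L2) < ε) →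
    ω ∈ dom ∧
      Filter.Tendsto (fun n => δ.form k (u n - ω : K.L2) (u n - ω : K.L2)) Filter.atTop (𝓝 0)

variable {δ}

theorem Coboundary.form_summable {k : Kind} {ω η : K.L2} (hω : ω ∈ δ.neumannDomain k)
    (hη : η ∈ δ.neumannDomain k) :
    Summable fun σ => δ.firstOrder k ω σ * δ.firstOrder k η σ := by
  have h := lp.summable_inner (𝕜 := ℝ) (⟨_, hη⟩ : K.L2) (⟨_, hω⟩ : K.L2)
  simpa using h

/-- The graph of the operator associated with `Q`: all pairs `(η, h)` with `η ∈ D(Q)` and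
`Q(ω, η) = ⟪ω, h⟫` for all `ω ∈ D(Q)`. -/
def Coboundary.ClosedForm.graph {k : Kind} (Q : δ.ClosedForm k) : Submodule ℝ (K.L2 × K.L2) where
  carrier := {p | p.1 ∈ Q.dom ∧ ∀ ω ∈ Q.dom, δ.form k ω p.1 = ⟪ω, p.2⟫_ℝ}
  zero_mem' := by
    refine ⟨Q.dom.zero_mem, fun ω _ => ?_⟩
    rw [Prod.snd_zero, inner_zero_right]
    change (∑' σ, δ.firstOrder k ω σ * δ.firstOrder k (0 : K.Simplex → ℝ) σ) = 0
    simp only [map_zero, Pi.zero_apply, mul_zero, tsum_zero]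
  add_mem' {p q} hp hq := by
    refine ⟨Q.dom.add_mem hp.1 hq.1, fun ω hω => ?_⟩
    rw [Prod.snd_add, inner_add_right, ← hp.2 ω hω, ← hq.2 ω hω]
    unfold Coboundary.form
    rw [← (Coboundary.form_summable (Q.le_neumann hω) (Q.le_neumann hp.1)).tsum_add
      (Coboundary.form_summable (Q.le_neumann hω) (Q.le_neumann hq.1))]
    simp only [Prod.fst_add, lp.coeFn_add, map_add, Pi.add_apply, mul_add]
  smul_mem' c p hp := by
    refine ⟨Q.dom.smul_mem c hp.1, fun ω hω => ?_⟩
    rw [Prod.smul_snd, real_inner_smul_right, ← hp.2 ω hω]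
    unfold Coboundary.form
    rw [← tsum_mul_left]
    simp only [Prod.smul_fst, lp.coeFn_smul, map_smul, Pi.smul_apply, smul_eq_mul]
    exact tsum_congr fun _ => by ring

/-- The Laplacian associated with `Q`: the unbounded operator on `ℓ²` with
`D(Δ) = {η ∈ D(Q) | ∃ h ∈ ℓ², ∀ ω ∈ D(Q), Q(ω, η) = ⟪ω, h⟫}` and `Δ η = h`. -/
def Coboundary.ClosedForm.laplacian {k : Kind} (Q : δ.ClosedForm k) : K.L2 →ₗ.[ℝ] K.L2 :=
  Q.graph.toLinearPMap

/-- The restriction `Δ_c` of the Laplacian to the finitely supported functions. -/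
def Coboundary.ClosedForm.laplacianC {k : Kind} (Q : δ.ClosedForm k) : K.L2 →ₗ.[ℝ] K.L2 :=
  Q.laplacian.domRestrict K.finSupp

end AbstractSimplicialComplex

/-! ### Properties of unbounded operators on a real Hilbert space -/

/-- A bounded, everywhere defined operator. -/
def LinearPMap.IsBoundedOp {H : Type*} [NormedAddCommGroup H] [InnerProductSpace ℝ H]
    (T : H →ₗ.[ℝ] H) : Prop :=
  T.domain = ⊤ ∧ ∃ C : ℝ, ∀ x : T.domain, ‖T x‖ ≤ C * ‖(x : H)‖

/-- Essential self-adjointness: the operator is densely defined and closable, and its closure is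
self-adjoint. -/
def LinearPMap.IsEssentiallySelfAdjoint {H : Type*} [NormedAddCommGroup H]
    [InnerProductSpace ℝ H] [CompleteSpace H] (T : H →ₗ.[ℝ] H) : Prop :=
  Dense (T.domain : Set H) ∧ T.IsClosable ∧ IsSelfAdjoint T.closure

namespace AbstractSimplicialComplex

variable {V : Type*} (K : AbstractSimplicialComplex V)

/-! ### Vertex degree, degree path metric, Forman curvature -/

/-- The number of 1-simplices that contain the vertex `v`. -/
def deg (v : V) : ℕ := {e : K.Simplex | e.1.card = 2 ∧ v ∈ e.1}.ncard

/-- The length of a path in the 1-skeleton, where the edge from `v` to `w` has length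
`max (deg v) (deg w) ^ (-1/2)`. -/
def degLength {v w : V} (p : K.oneSkeleton.Walk v w) : ℝ :=
  (p.darts.map fun d => 1 / √(max (K.deg d.fst : ℝ) (K.deg d.snd : ℝ))).sum

/-- The degree path metric: the infimum of the lengths of all paths from `v` to `w`. -/
def degDist (v w : V) : ℝ := ⨅ p : K.oneSkeleton.Walk v w, K.degLength p

variable {K}

open Classical in
/-- `b⁺(τ, τ')` for `m ≡ 1`: the indicator of `τ, τ' ≺ τ ∪ τ' ∈ Σ`. -/
def bUp (τ τ' : K.Simplex) : ℝ :=
  if ∃ σ : K.Simplex, σ.1 = τ.1 ∪ τ'.1 ∧ IsFace τ σ ∧ IsFace τ' σ then 1 else 0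

open Classical in
/-- `b⁻(τ, τ')` for `m ≡ 1`: the indicator of `Σ ∋ τ ∩ τ' ≺ τ, τ'`. -/
def bDown (τ τ' : K.Simplex) : ℝ :=
  if ∃ ρ : K.Simplex, ρ.1 = τ.1 ∩ τ'.1 ∧ IsFace ρ τ ∧ IsFace ρ τ' then 1 else 0

/-- `b^H = |b⁻ - b⁺|`. -/
def bHodge (τ τ' : K.Simplex) : ℝ := |bDown τ τ' - bUp τ τ'|

/-- The Forman curvature for `m ≡ 1`:
`c^H(τ) = #{ρ ≺ τ} + #{σ ≻ τ} - ∑_{τ'} b^H(τ, τ')`. -/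
def formanCurvature (τ : K.Simplex) : ℝ :=
  ({ρ : K.Simplex | IsFace ρ τ}.ncard : ℝ) + ({σ : K.Simplex | IsFace τ σ}.ncard : ℝ)
    - ∑' τ' : K.Simplex, bHodge τ τ'

end AbstractSimplicialComplex

end

open Filter

/-! ### A criterion for essential self-adjointness. -/

section EssentialSelfAdjointness

variable {H : Type*} [NormedAddCommGroup H] [InnerProductSpace ℝ H]

/-! Green's formula pairs an arbitrary function with a finitely supported one, so on `F^c` every
Laplacian acts as the formal operator `A*A`, whichever closed form was chosen. Local finiteness
keeps `A*Aφ` finitely supported, which gives (b).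

For (a), finite dimension bounds the number of faces and the degree bounds the number of cofaces of
nonempty simplices. A Schur test then bounds `δ` and `∂`, so `Q_D` is everything and `Δ = A*A`.
Conversely, test functions at a vertex have energy at least `deg v` times their squared norm.

For (c) and (d), a positive symmetric operator is essentially self-adjoint once its shift by some `c
> 0` has dense range. An obstruction is an `ℓ²` solution of `A*A u = -c u`. Since `δδ = 0` and `∂∂ =
0`, such a `u` also solves the Hodge equation (`formalLaplacian_hodge_eq_smul`), so the three kinds
reduce to one. The signs of `δ` make the up and down off-diagonal entries cancel whenever both
occur, so the Hodge matrix has off-diagonal entries `±b^H` (`abs_hodgeKernel`) and the Forman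
curvature measures its diagonal dominance.

In (c), `u` attains its maximal modulus, and the equation there contradicts diagonal dominance of
the shifted matrix. In (d), completeness makes path balls finite by a Hopf–Rinow argument
(`finite_pathBall`). Cutoffs built from the distance then have finite support and uniformly small
energy (`exists_cutoff`), and localization (`mul_sum_sq_le`) forces `u = 0`. -/

theorem Submodule.inner_comm_topologicalClosure {G : Submodule ℝ (H × H)}
    (hsym : ∀ p ∈ G, ∀ q ∈ G, ⟪p.2, q.1⟫_ℝ = ⟪p.1, q.2⟫_ℝ) {p q : H × H}
    (hp : p ∈ G.topologicalClosure) (hq : q ∈ G.topologicalClosure) :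
    ⟪p.2, q.1⟫_ℝ = ⟪p.1, q.2⟫_ℝ := by
  have h1 : ∀ q ∈ G, ∀ p ∈ G.topologicalClosure, ⟪p.2, q.1⟫_ℝ = ⟪p.1, q.2⟫_ℝ := by
    intro q hq p hp
    have hcl : IsClosed {p : H × H | ⟪p.2, q.1⟫_ℝ = ⟪p.1, q.2⟫_ℝ} :=
      isClosed_eq (by fun_prop) (by fun_prop)
    exact closure_minimal (fun p hp => hsym p hp q hq) hcl hp
  have hcl : IsClosed {q : H × H | ⟪p.2, q.1⟫_ℝ = ⟪p.1, q.2⟫_ℝ} :=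
    isClosed_eq (by fun_prop) (by fun_prop)
  exact closure_minimal (fun q hq => h1 q hq p hp) hcl hq

/-- If `T + c` is strictly positive and has dense range then its closure is onto. -/
theorem Submodule.exists_mem_topologicalClosure_of_dense_range [CompleteSpace H]
    {G : Submodule ℝ (H × H)} (hpos : ∀ p ∈ G, 0 ≤ ⟪p.2, p.1⟫_ℝ) {c : ℝ} (hc : 0 < c)
    (hker : ∀ u, (∀ p ∈ G, ⟪p.2 + c • p.1, u⟫_ℝ = 0) → u = 0) (g : H) :
    ∃ x, (x, g - c • x) ∈ G.topologicalClosure := by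
  let f : H × H →ₗ[ℝ] H := LinearMap.snd ℝ H H + c • LinearMap.fst ℝ H H
  have hf : ∀ p, f p = p.2 + c • p.1 := fun p => rfl
  -- Positivity makes the shifted operator bounded below, so preimages of a Cauchy sequence are
  -- Cauchy; this upgrades dense range to surjectivity of the closure.
  have hlow : ∀ p ∈ G, c * ‖p.1‖ ≤ ‖f p‖ := by
    intro p hp
    have h1 : c * ‖p.1‖ ^ 2 ≤ ‖f p‖ * ‖p.1‖ := by
      refine le_trans ?_ (real_inner_le_norm _ _)
      rw [hf, inner_add_left, real_inner_smul_left, real_inner_self_eq_norm_sq]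
      linarith [hpos p hp]
    rcases (norm_nonneg p.1).eq_or_lt with h0 | h0
    · rw [← h0, mul_zero]; exact norm_nonneg _
    · exact le_of_mul_le_mul_right (by linarith [h1, sq ‖p.1‖]) h0
  have hdense : (G.map f).topologicalClosure = ⊤ := by
    rw [Submodule.topologicalClosure_eq_top_iff, Submodule.eq_bot_iff]
    intro u hu
    refine hker u fun p hp => ?_
    exact (Submodule.mem_orthogonal _ _).1 hu _ (Submodule.mem_map_of_mem hp)
  have hg : g ∈ closure ((G.map f : Submodule ℝ H) : Set H) := by
    rw [← Submodule.topologicalClosure_coe, hdense]; trivial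
  obtain ⟨y, hy, hlim⟩ := mem_closure_iff_seq_limit.1 hg
  choose p hp hpy using fun n => Submodule.mem_map.1 (hy n)
  have hcau : CauchySeq fun n => (p n).1 := by
    rw [Metric.cauchySeq_iff]
    intro ε hε
    obtain ⟨N, hN⟩ := Metric.cauchySeq_iff.1 hlim.cauchySeq (c * ε) (by positivity)
    refine ⟨N, fun m hm n hn => ?_⟩
    have h1 := hN m hm n hn
    have h2 := hlow _ (G.sub_mem (hp m) (hp n))
    rw [map_sub, hpy, hpy] at h2
    rw [dist_eq_norm] at h1 ⊢
    exact lt_of_mul_lt_mul_left (h2.trans_lt h1) hc.le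
  obtain ⟨x, hx⟩ := cauchySeq_tendsto_of_complete hcau
  refine ⟨x, mem_closure_iff_seq_limit.2 ⟨p, hp, ?_⟩⟩
  have h2 : Tendsto (fun n => (p n).2) atTop (𝓝 (g - c • x)) := by
    refine (hlim.sub (hx.const_smul c)).congr fun n => ?_
    rw [← hpy, hf, add_sub_cancel_right]
  exact hx.prodMk_nhds h2

/-- A densely defined positive symmetric operator `T` is essentially self-adjoint if `T + c` has
dense range for some `c > 0`. -/
theorem LinearPMap.isEssentiallySelfAdjoint_of_ker [CompleteSpace H] {T : H →ₗ.[ℝ] H}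
    (hd : Dense (T.domain : Set H)) (hsym : T.IsFormalAdjoint T)
    (hpos : ∀ x : T.domain, 0 ≤ ⟪T x, (x : H)⟫_ℝ) {c : ℝ} (hc : 0 < c)
    (hker : ∀ u : H, (∀ x : T.domain, ⟪T x + c • (x : H), u⟫_ℝ = 0) → u = 0) :
    T.IsEssentiallySelfAdjoint := by
  have hcl : T.IsClosable :=
    (LinearPMap.adjoint_isClosed hd).isClosable.leIsClosable (hsym.le_adjoint hd)
  have hdS : Dense (T.closure.domain : Set H) := hd.mono T.le_closure.1
  refine ⟨hd, hcl, ?_⟩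
  have hgraph : ∀ p ∈ T.graph, ∃ x : T.domain, (x : H) = p.1 ∧ T x = p.2 := fun p hp =>
    (LinearPMap.mem_graph_iff T).1 hp
  have hsymG : ∀ p ∈ T.graph, ∀ q ∈ T.graph, ⟪p.2, q.1⟫_ℝ = ⟪p.1, q.2⟫_ℝ := by
    intro p hp q hq
    obtain ⟨x, hx, hTx⟩ := hgraph p hp
    obtain ⟨y, hy, hTy⟩ := hgraph q hq
    rw [← hx, ← hy, ← hTx, ← hTy]
    exact hsym x y
  rw [LinearPMap.isSelfAdjoint_def]
  refine LinearPMap.eq_of_eq_graph ?_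
  rw [LinearPMap.adjoint_graph_eq_graph_adjoint hdS, ← hcl.graph_closure_eq_closure_graph]
  ext ⟨u, h⟩
  rw [Submodule.mem_adjoint_iff]
  constructor
  · intro huh
    -- For `(u, h)` in the adjoint graph, solve `(T̄ + c) x = h + c u`. Then `u - x` is orthogonal
    -- to the range of `T + c`, hence zero.
    obtain ⟨x, hx⟩ := Submodule.exists_mem_topologicalClosure_of_dense_range (G := T.graph)
      (fun p hp => by
        obtain ⟨x, hx, hTx⟩ := hgraph p hp
        rw [← hx, ← hTx]; exact hpos x) hc
      (fun u hu => hker u fun x => hu (x, T x) (T.mem_graph x)) (h + c • u)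
    have hux : u - x = 0 := by
      refine hker _ fun y => ?_
      have hy := T.graph.le_topologicalClosure (T.mem_graph y)
      have h1 := huh _ _ hy
      have h2 := Submodule.inner_comm_topologicalClosure hsymG hy hx
      simp only [inner_sub_right, inner_add_left, inner_add_right, real_inner_smul_left,
        real_inner_smul_right] at h1 h2 ⊢
      linarith
    rw [sub_eq_zero] at hux
    subst hux
    simpa using hx
  · intro huh a b hab
    rw [sub_eq_zero]
    exact Submodule.inner_comm_topologicalClosure hsymG hab huh

end EssentialSelfAdjointness

/-! ### Summation by parts. -/

section KernelGreen

/-- Summation by parts for a kernel with finite rows and columns. -/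
theorem tsum_sum_mul_eq_tsum_mul_sum {α : Type*} (θ : α → α → ℝ) {r c : α → Finset α}
    (h : ∀ x y, y ∈ r x ↔ x ∈ c y) (ω : α → ℝ) {ψ : α → ℝ} (hψ : (Function.support ψ).Finite) :
    ∑' x, (∑ y ∈ r x, ω y * θ x y) * ψ x = ∑' y, ω y * ∑ x ∈ c y, ψ x * θ x y := by
  classical
  rw [tsum_eq_sum (s := hψ.toFinset) fun x hx => by
      rw [show ψ x = 0 by simpa using hx, mul_zero],
    tsum_eq_sum (s := hψ.toFinset.biUnion r) fun y hy => by
      rw [Finset.sum_eq_zero, mul_zero]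
      intro x hx
      by_contra h0
      exact hy (Finset.mem_biUnion.2
        ⟨x, by simpa using left_ne_zero_of_mul h0, (h x y).2 hx⟩)]
  simp only [Finset.sum_mul, Finset.mul_sum]
  have h2 : ∀ y, ∑ x ∈ c y, ω y * (ψ x * θ x y)
      = ∑ x ∈ hψ.toFinset.filter (fun x => y ∈ r x), ω y * (ψ x * θ x y) := by
    intro y
    symm
    refine Finset.sum_subset (fun x hx => (h x y).1 (Finset.mem_filter.1 hx).2) fun x hx hx' => ?_
    have : ψ x = 0 := by
      by_contra h0
      exact hx' (Finset.mem_filter.2 ⟨by simpa using h0, (h x y).2 hx⟩)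
    rw [this, zero_mul, mul_zero]
  simp only [h2]
  rw [Finset.sum_comm' (t' := hψ.toFinset.biUnion r)
    (s' := fun y => hψ.toFinset.filter (fun x => y ∈ r x))]
  · exact Finset.sum_congr rfl fun y _ => Finset.sum_congr rfl fun x _ => by ring
  · intro x y
    simp only [Finset.mem_filter, Finset.mem_biUnion]
    exact ⟨fun h => ⟨h, x, h⟩, fun h => h.1⟩

end KernelGreen

/-! ### Incidence of simplices. -/

namespace AbstractSimplicialComplex

variable {V : Type*} {K : AbstractSimplicialComplex V}

/-- The finset of faces of a simplex. -/
noncomputable def faceFinset (σ : K.Simplex) : Finset K.Simplex := (finite_faces σ).toFinset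

@[simp]
theorem mem_faceFinset {τ σ : K.Simplex} : τ ∈ faceFinset σ ↔ IsFace τ σ := by
  simp [faceFinset]

/-- The union is strictly larger than `τ` and lies in `σ`, which has only one more vertex. Hence
distinct simplices share at most one coface, and an off-diagonal Hodge entry has at most one up
term. -/
theorem IsFace.eq_union {τ τ' σ : K.Simplex} [DecidableEq V] (hne : τ ≠ τ') (h : IsFace τ σ)
    (h' : IsFace τ' σ) : σ.1 = τ.1 ∪ τ'.1 := by
  symm
  refine Finset.eq_of_subset_of_card_le (Finset.union_subset h.1 h'.1) ?_
  have hss : τ.1 ⊂ τ.1 ∪ τ'.1 := by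
    refine Finset.subset_union_left.ssubset_of_ne fun he => hne ?_
    have hsub : τ'.1 ⊆ τ.1 := by rw [he]; exact Finset.subset_union_right
    exact Subtype.ext (Finset.eq_of_subset_of_card_le hsub (by have := h.2; have := h'.2; omega)).symm
  have := Finset.card_lt_card hss
  have := h.2
  omega

theorem IsFace.eq_inter {ρ τ τ' : K.Simplex} [DecidableEq V] (hne : τ ≠ τ') (h : IsFace ρ τ)
    (h' : IsFace ρ τ') : ρ.1 = τ.1 ∩ τ'.1 := by
  refine Finset.eq_of_subset_of_card_le (Finset.subset_inter h.1 h'.1) ?_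
  have hss : τ.1 ∩ τ'.1 ⊂ τ.1 := by
    refine Finset.inter_subset_left.ssubset_of_ne fun he => hne ?_
    have hsub : τ.1 ⊆ τ'.1 := by rw [← he]; exact Finset.inter_subset_right
    exact Subtype.ext (Finset.eq_of_subset_of_card_le hsub (by have := h.2; have := h'.2; omega))
  have := Finset.card_lt_card hss
  have := h.2
  omega

/-- Between `τ ∩ τ'` and `τ ∪ τ'` there are only `τ` and `τ'`. -/
theorem IsFace.eq_or_eq {ρ τ τ' σ κ : K.Simplex} (hne : τ ≠ τ') (h1 : IsFace ρ τ)
    (h1' : IsFace ρ τ') (h2 : IsFace τ σ) (h2' : IsFace τ' σ) (hρ : IsFace ρ κ)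
    (hσ : IsFace κ σ) : κ = τ ∨ κ = τ' := by
  classical
  -- The vertex `c` that `κ` adds to `ρ` lies in `τ` or in `τ'`, and each of these is `ρ` plus one
  -- vertex.
  obtain ⟨c, hcκ, hcρ⟩ : ∃ c ∈ κ.1, c ∉ ρ.1 := by
    by_contra! hcon
    have := Finset.card_le_card hcon
    have := hρ.2
    omega
  have key : ∀ x : K.Simplex, IsFace ρ x → c ∈ x.1 → insert c ρ.1 = x.1 := fun x hx hc =>
    Finset.eq_of_subset_of_card_le (Finset.insert_subset hc hx.1)
      (by rw [Finset.card_insert_of_notMem hcρ, hx.2])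
  have hc : c ∈ τ.1 ∪ τ'.1 := IsFace.eq_union hne h2 h2' ▸ hσ.1 hcκ
  rcases Finset.mem_union.1 hc with hc | hc
  · exact Or.inl (Subtype.ext ((key κ hρ hcκ).symm.trans (key τ h1 hc)))
  · exact Or.inr (Subtype.ext ((key κ hρ hcκ).symm.trans (key τ' h1' hc)))

theorem bUp_of_isFace {x y σ : K.Simplex} (hne : x ≠ y)
    (hx : IsFace x σ) (hy : IsFace y σ) : bUp x y = 1 := by
  classical
  unfold bUp
  rw [if_pos ⟨σ, by convert IsFace.eq_union hne hx hy, hx, hy⟩]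

theorem bDown_of_isFace {x y ρ : K.Simplex} (hne : x ≠ y)
    (hx : IsFace ρ x) (hy : IsFace ρ y) : bDown x y = 1 := by
  classical
  unfold bDown
  rw [if_pos ⟨ρ, by convert IsFace.eq_inter hne hx hy, hx, hy⟩]

theorem bUp_eq_zero {x y : K.Simplex}
    (h : ¬ ∃ σ, IsFace x σ ∧ IsFace y σ) : bUp x y = 0 :=
  if_neg fun ⟨σ, _, hσ⟩ => h ⟨σ, hσ⟩

theorem bDown_eq_zero {x y : K.Simplex}
    (h : ¬ ∃ ρ, IsFace ρ x ∧ IsFace ρ y) : bDown x y = 0 :=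
  if_neg fun ⟨ρ, _, hρ⟩ => h ⟨ρ, hρ⟩

/-! ### Sign identities from `δδ = 0`. -/

namespace Coboundary

variable (δ : K.Coboundary)

theorem sign_ne_zero {τ σ : K.Simplex} : δ.sign τ σ ≠ 0 ↔ IsFace τ σ := δ.sign_ne_zero_iff τ σ

theorem sign_eq_zero {τ σ : K.Simplex} (h : ¬ IsFace τ σ) : δ.sign τ σ = 0 :=
  not_not.1 (mt δ.sign_ne_zero.1 h)

theorem sign_mul_self {τ σ : K.Simplex} (h : IsFace τ σ) : δ.sign τ σ * δ.sign τ σ = 1 := by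
  have h0 := δ.sign_ne_zero.2 h
  rcases δ.sign_mem τ σ with h1 | h1 | h1
  · change δ.sign τ σ = -1 at h1; rw [h1]; norm_num
  · exact absurd h1 h0
  · change δ.sign τ σ = 1 at h1; rw [h1]; norm_num

theorem abs_sign_le_one (τ σ : K.Simplex) : |δ.sign τ σ| ≤ 1 := by
  by_cases h : IsFace τ σ
  · have := δ.sign_mul_self h
    exact abs_le_one_iff_mul_self_le_one.2 this.le
  · rw [δ.sign_eq_zero h]; simp

theorem toLin_apply (ω : K.Simplex → ℝ) (σ : K.Simplex) :
    δ.toLin ω σ = ∑ τ ∈ faceFinset σ, ω τ * δ.sign τ σ := δ.apply_eq ω σ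

theorem toLin_apply_of_subset (ω : K.Simplex → ℝ) {σ : K.Simplex} {F : Finset K.Simplex}
    (hF : faceFinset σ ⊆ F) : δ.toLin ω σ = ∑ τ ∈ F, ω τ * δ.sign τ σ := by
  rw [toLin_apply]
  refine Finset.sum_subset hF fun τ _ h => ?_
  rw [δ.sign_eq_zero (by simpa using h), mul_zero]

theorem toLin_toLin (ω : K.Simplex → ℝ) : δ.toLin (δ.toLin ω) = 0 :=
  LinearMap.congr_fun δ.comp_self ω

theorem toLin_single [DecidableEq K.Simplex] (τ σ : K.Simplex) :
    δ.toLin (Pi.single τ 1) σ = δ.sign τ σ := by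
  unfold sign
  congr!

theorem sum_sign_mul_sign (ρ σ : K.Simplex) :
    ∑ τ ∈ faceFinset σ, δ.sign ρ τ * δ.sign τ σ = 0 := by
  classical
  have h := congrFun (δ.toLin_toLin (Pi.single ρ 1)) σ
  rw [toLin_apply] at h
  simpa only [toLin_single, Pi.zero_apply] using h

/-- Only `τ` and `τ'` lie between `ρ` and `σ`, so `δδ 1_ρ (σ) = 0` has just two terms; multiply it
by `θ(ρ, τ') θ(τ, σ)`. This cancellation is the origin of the difference in `b^H = |b⁻ - b⁺|`. -/
theorem sign_mul_sign_add_sign_mul_sign {ρ τ τ' σ : K.Simplex} (hne : τ ≠ τ') (h1 : IsFace ρ τ)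
    (h1' : IsFace ρ τ') (h2 : IsFace τ σ) (h2' : IsFace τ' σ) :
    δ.sign τ σ * δ.sign τ' σ + δ.sign ρ τ * δ.sign ρ τ' = 0 := by
  classical
  have h := δ.sum_sign_mul_sign ρ σ
  have hsub : ({τ, τ'} : Finset K.Simplex) ⊆ faceFinset σ := by
    intro x hx
    rcases Finset.mem_insert.1 hx with rfl | hx
    · simpa using h2
    · rw [Finset.mem_singleton.1 hx]; simpa using h2'
  rw [← Finset.sum_subset hsub, Finset.sum_pair hne] at h
  · have e1 := δ.sign_mul_self h1'
    have e2 := δ.sign_mul_self h2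
    linear_combination (δ.sign ρ τ' * δ.sign τ σ) * h - (δ.sign ρ τ * δ.sign ρ τ') * e2
      - (δ.sign τ σ * δ.sign τ' σ) * e1
  · intro κ hκ hκ'
    by_cases hρ : IsFace ρ κ
    · refine absurd ?_ hκ'
      simpa using IsFace.eq_or_eq hne h1 h1' h2 h2' hρ (mem_faceFinset.1 hκ)
    · rw [δ.sign_eq_zero hρ, zero_mul]

theorem sum_face_sign_mul_sign {x y ρ : K.Simplex} (hne : x ≠ y) (hx : IsFace ρ x)
    (hy : IsFace ρ y) :
    ∑ κ ∈ faceFinset x, δ.sign κ x * δ.sign κ y = δ.sign ρ x * δ.sign ρ y := by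
  classical
  refine Finset.sum_eq_single_of_mem ρ (mem_faceFinset.2 hx) fun κ hκ hκρ => ?_
  rw [δ.sign_eq_zero (σ := y), mul_zero]
  intro hyκ
  exact hκρ (Subtype.ext ((IsFace.eq_inter hne (mem_faceFinset.1 hκ) hyκ).trans
    (IsFace.eq_inter hne hx hy).symm))

theorem sum_face_sign_mul_sign_eq_zero {x y : K.Simplex}
    (h : ¬ ∃ ρ, IsFace ρ x ∧ IsFace ρ y) :
    ∑ κ ∈ faceFinset x, δ.sign κ x * δ.sign κ y = 0 :=
  Finset.sum_eq_zero fun κ hκ => by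
    rw [δ.sign_eq_zero fun hy => h ⟨κ, mem_faceFinset.1 hκ, hy⟩, mul_zero]

theorem abs_sign_mul_sign {x y x' y' : K.Simplex} (h : IsFace x y) (h' : IsFace x' y') :
    |δ.sign x y * δ.sign x' y'| = 1 := by
  have e : |δ.sign x y * δ.sign x' y'| * |δ.sign x y * δ.sign x' y'| = 1 * 1 := by
    rw [abs_mul_abs_self]
    linear_combination δ.sign_mul_self h * (δ.sign x' y' * δ.sign x' y') + δ.sign_mul_self h'
  exact (mul_self_inj (abs_nonneg _) zero_le_one).1 e

end Coboundary

/-! ### Green's formula and the formal Laplacians. -/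

variable [hK : K.LocallyFinite]

/-- The finset of cofaces of a simplex. -/
noncomputable def cofaceFinset (τ : K.Simplex) : Finset K.Simplex :=
  (hK.finite_cofaces τ).toFinset

@[simp]
theorem mem_cofaceFinset {τ σ : K.Simplex} : σ ∈ cofaceFinset τ ↔ IsFace τ σ := by
  simp [cofaceFinset]

/-- The dual kind: the formal adjoint of the first order operator of kind `k` is the one of
kind `k.dual`. -/
def Kind.dual : Kind → Kind
  | .up => .down
  | .down => .up
  | .hodge => .hodge

namespace Coboundary

variable (δ : K.Coboundary)

theorem boundary_apply (ω : K.Simplex → ℝ) (ρ : K.Simplex) :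
    δ.boundary ω ρ = ∑ τ ∈ cofaceFinset ρ, ω τ * δ.sign ρ τ := rfl

theorem boundary_apply_of_subset (ω : K.Simplex → ℝ) {ρ : K.Simplex} {F : Finset K.Simplex}
    (hF : cofaceFinset ρ ⊆ F) : δ.boundary ω ρ = ∑ τ ∈ F, ω τ * δ.sign ρ τ := by
  rw [boundary_apply]
  refine Finset.sum_subset hF fun τ _ h => ?_
  rw [δ.sign_eq_zero (by simpa using h), mul_zero]

theorem finite_support_toLin {ψ : K.Simplex → ℝ} (hψ : (Function.support ψ).Finite) :
    (Function.support (δ.toLin ψ)).Finite := by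
  refine (hψ.biUnion fun τ _ => hK.finite_cofaces τ).subset fun σ hσ => ?_
  rw [Function.mem_support, toLin_apply] at hσ
  obtain ⟨τ, hτ, h⟩ := Finset.exists_ne_zero_of_sum_ne_zero hσ
  exact Set.mem_biUnion (left_ne_zero_of_mul h) (mem_faceFinset.1 hτ)

theorem finite_support_boundary {ψ : K.Simplex → ℝ} (hψ : (Function.support ψ).Finite) :
    (Function.support (δ.boundary ψ)).Finite := by
  refine (hψ.biUnion fun τ _ => finite_faces τ).subset fun σ hσ => ?_
  rw [Function.mem_support, boundary_apply] at hσ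
  obtain ⟨τ, hτ, h⟩ := Finset.exists_ne_zero_of_sum_ne_zero hσ
  exact Set.mem_biUnion (left_ne_zero_of_mul h) (mem_cofaceFinset.1 hτ)

theorem finite_support_firstOrder (k : Kind) {ψ : K.Simplex → ℝ}
    (hψ : (Function.support ψ).Finite) : (Function.support (δ.firstOrder k ψ)).Finite := by
  cases k with
  | up => exact δ.finite_support_toLin hψ
  | down => exact δ.finite_support_boundary hψ
  | hodge =>
    exact ((δ.finite_support_toLin hψ).union (δ.finite_support_boundary hψ)).subset
      (Function.support_add _ _)

theorem tsum_toLin_mul (ω : K.Simplex → ℝ) {ψ : K.Simplex → ℝ}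
    (hψ : (Function.support ψ).Finite) :
    ∑' σ, δ.toLin ω σ * ψ σ = ∑' τ, ω τ * δ.boundary ψ τ := by
  simp only [toLin_apply, boundary_apply]
  exact tsum_sum_mul_eq_tsum_mul_sum (fun x y => δ.sign y x) (by simp) ω hψ

theorem tsum_boundary_mul (ω : K.Simplex → ℝ) {ψ : K.Simplex → ℝ}
    (hψ : (Function.support ψ).Finite) :
    ∑' σ, δ.boundary ω σ * ψ σ = ∑' τ, ω τ * δ.toLin ψ τ := by
  simp only [toLin_apply, boundary_apply]
  exact tsum_sum_mul_eq_tsum_mul_sum (fun x y => δ.sign x y) (by simp) ω hψ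

/-- Green's formula. -/
theorem tsum_firstOrder_mul (k : Kind) (ω : K.Simplex → ℝ) {ψ : K.Simplex → ℝ}
    (hψ : (Function.support ψ).Finite) :
    ∑' σ, δ.firstOrder k ω σ * ψ σ = ∑' τ, ω τ * δ.firstOrder k.dual ψ τ := by
  cases k with
  | up => exact δ.tsum_toLin_mul ω hψ
  | down => exact δ.tsum_boundary_mul ω hψ
  | hodge =>
    have hr : ∀ f : K.Simplex → ℝ, Summable fun σ => f σ * ψ σ := fun f =>
      summable_of_hasFiniteSupport (hψ.subset (Function.support_mul_subset_right _ _))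
    have hl : ∀ φ : K.Simplex → ℝ, (Function.support φ).Finite → Summable fun σ => ω σ * φ σ :=
      fun φ hφ => summable_of_hasFiniteSupport (hφ.subset (Function.support_mul_subset_right _ _))
    simp only [firstOrder, Kind.dual, LinearMap.add_apply, Pi.add_apply, add_mul, mul_add]
    rw [(hr _).tsum_add (hr _), (hl _ (δ.finite_support_toLin hψ)).tsum_add
      (hl _ (δ.finite_support_boundary hψ)), δ.tsum_toLin_mul ω hψ, δ.tsum_boundary_mul ω hψ,
      add_comm]

/-- Dual to `δδ = 0`: testing with point masses moves both operators onto a finitely supported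
function, so no summability of `ω` is needed. -/
theorem boundary_boundary (ω : K.Simplex → ℝ) : δ.boundary (δ.boundary ω) = 0 := by
  classical
  funext ρ
  have hf : (Function.support (Pi.single ρ (1 : ℝ) : K.Simplex → ℝ)).Finite :=
    (Set.finite_singleton ρ).subset Pi.support_single_subset
  have h := δ.tsum_boundary_mul (δ.boundary ω) hf
  rw [δ.tsum_boundary_mul ω (δ.finite_support_toLin hf), δ.toLin_toLin] at h
  rw [tsum_eq_single ρ fun σ hσ => by simp [hσ]] at h
  simpa using h

/-- The formal Laplacian `A* A`. -/
noncomputable def formalLaplacian (k : Kind) : (K.Simplex → ℝ) →ₗ[ℝ] (K.Simplex → ℝ) :=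
  δ.firstOrder k.dual ∘ₗ δ.firstOrder k

theorem formalLaplacian_apply (k : Kind) (ω : K.Simplex → ℝ) :
    δ.formalLaplacian k ω = δ.firstOrder k.dual (δ.firstOrder k ω) := rfl

theorem finite_support_formalLaplacian (k : Kind) {ψ : K.Simplex → ℝ}
    (hψ : (Function.support ψ).Finite) : (Function.support (δ.formalLaplacian k ψ)).Finite :=
  δ.finite_support_firstOrder _ (δ.finite_support_firstOrder _ hψ)

theorem formalLaplacian_hodge (ω : K.Simplex → ℝ) :
    δ.formalLaplacian .hodge ω = δ.boundary (δ.toLin ω) + δ.toLin (δ.boundary ω) := by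
  simp only [formalLaplacian_apply, firstOrder, Kind.dual, LinearMap.add_apply, map_add,
    δ.toLin_toLin, δ.boundary_boundary, zero_add, add_zero]

theorem tsum_formalLaplacian_mul (k : Kind) (ω : K.Simplex → ℝ) {ψ : K.Simplex → ℝ}
    (hψ : (Function.support ψ).Finite) :
    ∑' σ, δ.formalLaplacian k ω σ * ψ σ = ∑' τ, ω τ * δ.formalLaplacian k ψ τ := by
  have hd : k.dual.dual = k := by cases k <;> rfl
  rw [formalLaplacian_apply, tsum_firstOrder_mul _ _ _ hψ, hd,
    tsum_firstOrder_mul _ _ _ (δ.finite_support_firstOrder _ hψ)]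
  rfl

/-- An eigenfunction of the up or down Laplacian to a nonzero eigenvalue is an eigenfunction of the
Hodge Laplacian. -/
theorem formalLaplacian_hodge_eq_smul (k : Kind) {c : ℝ} (hc : c ≠ 0) {u : K.Simplex → ℝ}
    (hu : δ.formalLaplacian k u = c • u) : δ.formalLaplacian .hodge u = c • u := by
  cases k with
  | hodge => exact hu
  | up =>
    change δ.boundary (δ.toLin u) = c • u at hu
    -- Apply `∂` to the eigenvalue equation: `∂∂δu = 0` gives `c ∂u = 0`, so the missing half of the
    -- Hodge Laplacian vanishes on `u`.
    have h0 : δ.boundary u = 0 := by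
      have h := congrArg δ.boundary hu
      rw [δ.boundary_boundary, map_smul] at h
      exact (smul_eq_zero.1 h.symm).resolve_left hc
    rw [formalLaplacian_hodge, hu, h0, map_zero, add_zero]
  | down =>
    change δ.toLin (δ.boundary u) = c • u at hu
    have h0 : δ.toLin u = 0 := by
      have h := congrArg δ.toLin hu
      rw [δ.toLin_toLin, map_smul] at h
      exact (smul_eq_zero.1 h.symm).resolve_left hc
    rw [formalLaplacian_hodge, hu, h0, map_zero, zero_add]

/-! ### The Hodge Laplacian as a matrix. -/

/-- The matrix of the formal Hodge Laplacian. -/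
noncomputable def hodgeKernel (x y : K.Simplex) : ℝ :=
  ∑ σ ∈ cofaceFinset x, δ.sign x σ * δ.sign y σ + ∑ ρ ∈ faceFinset x, δ.sign ρ x * δ.sign ρ y

theorem hodgeKernel_eq {x y : K.Simplex} {F G : Finset K.Simplex} (hF : cofaceFinset x ⊆ F)
    (hG : faceFinset x ⊆ G) : δ.hodgeKernel x y =
      ∑ σ ∈ F, δ.sign x σ * δ.sign y σ + ∑ ρ ∈ G, δ.sign ρ x * δ.sign ρ y := by
  unfold hodgeKernel
  congr 1
  · refine Finset.sum_subset hF fun σ _ h => ?_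
    rw [δ.sign_eq_zero (by simpa using h), zero_mul]
  · refine Finset.sum_subset hG fun σ _ h => ?_
    rw [δ.sign_eq_zero (by simpa using h), zero_mul]

theorem hodgeKernel_symm (x y : K.Simplex) : δ.hodgeKernel x y = δ.hodgeKernel y x := by
  classical
  rw [δ.hodgeKernel_eq (x := x) (y := y) (F := cofaceFinset x ∪ cofaceFinset y)
      (G := faceFinset x ∪ faceFinset y) Finset.subset_union_left Finset.subset_union_left,
    δ.hodgeKernel_eq (x := y) (y := x) (F := cofaceFinset x ∪ cofaceFinset y)
      (G := faceFinset x ∪ faceFinset y) Finset.subset_union_right Finset.subset_union_right]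
  simp only [mul_comm]

/-- The double sum is `‖δ(φ 1_F)‖² + ‖∂(φ 1_F)‖²`, written over the finitely many cofaces and faces
that `F` meets. -/
theorem sum_sum_hodgeKernel_nonneg (F : Finset K.Simplex) (φ : K.Simplex → ℝ) :
    0 ≤ ∑ x ∈ F, ∑ y ∈ F, δ.hodgeKernel x y * (φ x * φ y) := by
  classical
  have h : ∑ x ∈ F, ∑ y ∈ F, δ.hodgeKernel x y * (φ x * φ y)
      = ∑ σ ∈ F.biUnion cofaceFinset, (∑ x ∈ F, φ x * δ.sign x σ) ^ 2
        + ∑ ρ ∈ F.biUnion faceFinset, (∑ x ∈ F, φ x * δ.sign ρ x) ^ 2 := by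
    have h1 : ∀ x ∈ F, ∑ y ∈ F, δ.hodgeKernel x y * (φ x * φ y)
        = ∑ σ ∈ F.biUnion cofaceFinset, ∑ y ∈ F, (φ x * δ.sign x σ) * (φ y * δ.sign y σ)
          + ∑ ρ ∈ F.biUnion faceFinset, ∑ y ∈ F, (φ x * δ.sign ρ x) * (φ y * δ.sign ρ y) := by
      intro x hx
      rw [Finset.sum_comm, Finset.sum_comm (s := F.biUnion faceFinset), ← Finset.sum_add_distrib]
      refine Finset.sum_congr rfl fun y _ => ?_
      rw [δ.hodgeKernel_eq (Finset.subset_biUnion_of_mem cofaceFinset hx)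
        (Finset.subset_biUnion_of_mem faceFinset hx), add_mul, Finset.sum_mul, Finset.sum_mul]
      congr 1 <;> exact Finset.sum_congr rfl fun σ _ => by ring
    rw [Finset.sum_congr rfl h1, Finset.sum_add_distrib, Finset.sum_comm,
      Finset.sum_comm (s := F) (t := F.biUnion faceFinset)]
    simp only [sq, Finset.sum_mul_sum]
  rw [h]
  positivity

open Classical in
/-- The simplices that share a coface or a face with `x`. -/
noncomputable def _root_.AbstractSimplicialComplex.nbhd (x : K.Simplex) : Finset K.Simplex :=
  (cofaceFinset x).biUnion faceFinset ∪ (faceFinset x).biUnion cofaceFinset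

theorem faceFinset_subset_nbhd {x σ : K.Simplex} (h : IsFace x σ) : faceFinset σ ⊆ nbhd x := by
  classical
  exact fun _ hy => Finset.mem_union_left _ (Finset.mem_biUnion.2 ⟨σ, mem_cofaceFinset.2 h, hy⟩)

theorem cofaceFinset_subset_nbhd {x ρ : K.Simplex} (h : IsFace ρ x) : cofaceFinset ρ ⊆ nbhd x := by
  classical
  exact fun _ hy => Finset.mem_union_right _ (Finset.mem_biUnion.2 ⟨ρ, mem_faceFinset.2 h, hy⟩)

theorem formalLaplacian_hodge_apply (u : K.Simplex → ℝ) {x : K.Simplex} {F : Finset K.Simplex}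
    (hF : nbhd x ⊆ F) : δ.formalLaplacian .hodge u x = ∑ y ∈ F, δ.hodgeKernel x y * u y := by
  rw [formalLaplacian_hodge, Pi.add_apply, boundary_apply, toLin_apply]
  simp only [hodgeKernel, add_mul, Finset.sum_add_distrib, Finset.sum_mul]
  rw [Finset.sum_comm, Finset.sum_comm (s := F)]
  congr 1
  · refine Finset.sum_congr rfl fun σ hσ => ?_
    rw [δ.toLin_apply_of_subset u ((faceFinset_subset_nbhd (mem_cofaceFinset.1 hσ)).trans hF),
      Finset.sum_mul]
    exact Finset.sum_congr rfl fun y _ => by ring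
  · refine Finset.sum_congr rfl fun σ hσ => ?_
    rw [δ.boundary_apply_of_subset u ((cofaceFinset_subset_nbhd (mem_faceFinset.1 hσ)).trans hF),
      Finset.sum_mul]
    exact Finset.sum_congr rfl fun y _ => by ring

theorem hodgeKernel_self (x : K.Simplex) :
    δ.hodgeKernel x x = (cofaceFinset x).card + (faceFinset x).card := by
  unfold hodgeKernel
  rw [Finset.sum_congr rfl fun σ hσ => δ.sign_mul_self (mem_cofaceFinset.1 hσ),
    Finset.sum_congr rfl fun σ hσ => δ.sign_mul_self (mem_faceFinset.1 hσ)]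
  simp

theorem sum_coface_sign_mul_sign {x y σ : K.Simplex} (hne : x ≠ y) (hx : IsFace x σ)
    (hy : IsFace y σ) :
    ∑ κ ∈ cofaceFinset x, δ.sign x κ * δ.sign y κ = δ.sign x σ * δ.sign y σ := by
  classical
  refine Finset.sum_eq_single_of_mem σ (mem_cofaceFinset.2 hx) fun κ hκ hκσ => ?_
  rw [δ.sign_eq_zero (τ := y), mul_zero]
  intro hyκ
  exact hκσ (Subtype.ext ((IsFace.eq_union hne (mem_cofaceFinset.1 hκ) hyκ).trans
    (IsFace.eq_union hne hx hy).symm))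

theorem sum_coface_sign_mul_sign_eq_zero {x y : K.Simplex}
    (h : ¬ ∃ σ, IsFace x σ ∧ IsFace y σ) :
    ∑ κ ∈ cofaceFinset x, δ.sign x κ * δ.sign y κ = 0 :=
  Finset.sum_eq_zero fun κ hκ => by
    rw [δ.sign_eq_zero fun hy => h ⟨κ, mem_cofaceFinset.1 hκ, hy⟩, mul_zero]

/-- Off the diagonal the Hodge Laplacian has the entries `± b^H`. -/
theorem abs_hodgeKernel {x y : K.Simplex} (hne : x ≠ y) :
    |δ.hodgeKernel x y| = bHodge x y := by
  unfold hodgeKernel bHodge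
  by_cases hU : ∃ σ, IsFace x σ ∧ IsFace y σ <;> by_cases hD : ∃ ρ, IsFace ρ x ∧ IsFace ρ y
  · obtain ⟨σ, hxσ, hyσ⟩ := hU
    obtain ⟨ρ, hρx, hρy⟩ := hD
    rw [δ.sum_coface_sign_mul_sign hne hxσ hyσ, δ.sum_face_sign_mul_sign hne hρx hρy,
      bUp_of_isFace hne hxσ hyσ, bDown_of_isFace hne hρx hρy,
      δ.sign_mul_sign_add_sign_mul_sign hne hρx hρy hxσ hyσ, sub_self]
  · rw [δ.sum_face_sign_mul_sign_eq_zero hD, bDown_eq_zero hD]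
    obtain ⟨σ, hxσ, hyσ⟩ := hU
    rw [δ.sum_coface_sign_mul_sign hne hxσ hyσ, bUp_of_isFace hne hxσ hyσ, add_zero,
      δ.abs_sign_mul_sign hxσ hyσ]
    norm_num
  · rw [δ.sum_coface_sign_mul_sign_eq_zero hU, bUp_eq_zero hU]
    obtain ⟨ρ, hρx, hρy⟩ := hD
    rw [δ.sum_face_sign_mul_sign hne hρx hρy, bDown_of_isFace hne hρx hρy, zero_add,
      δ.abs_sign_mul_sign hρx hρy]
    norm_num
  · rw [δ.sum_coface_sign_mul_sign_eq_zero hU, δ.sum_face_sign_mul_sign_eq_zero hD,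
      bUp_eq_zero hU, bDown_eq_zero hD]
    norm_num

end Coboundary

end AbstractSimplicialComplex

/-! ### Forms and Laplacians on `ℓ²`. -/

namespace AbstractSimplicialComplex

variable {V : Type*} {K : AbstractSimplicialComplex V}

theorem memℓp_of_finite_support {f : K.Simplex → ℝ} (hf : (Function.support f).Finite) :
    Memℓp f 2 := by
  refine memℓp_gen (summable_of_hasFiniteSupport (hf.subset fun x hx => ?_))
  rw [Function.mem_support] at hx ⊢
  rintro h0
  simp [h0] at hx

/-- A finitely supported function as an element of `ℓ²`. -/
noncomputable def L2.ofFiniteSupport (f : K.Simplex → ℝ) (hf : (Function.support f).Finite) :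
    K.L2 := ⟨f, memℓp_of_finite_support hf⟩

@[simp]
theorem L2.coe_ofFiniteSupport (f : K.Simplex → ℝ) (hf : (Function.support f).Finite) :
    (L2.ofFiniteSupport f hf : K.Simplex → ℝ) = f := rfl

theorem L2.ofFiniteSupport_mem (f : K.Simplex → ℝ) (hf : (Function.support f).Finite) :
    L2.ofFiniteSupport f hf ∈ K.finSupp := hf

theorem L2.inner_eq (f g : K.L2) : ⟪f, g⟫_ℝ = ∑' σ, f σ * g σ := by
  rw [lp.inner_eq_tsum]
  exact tsum_congr fun σ => by simp [mul_comm]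

theorem L2.summable_mul (f g : K.L2) : Summable fun σ => f σ * g σ := by
  have h := lp.summable_inner (𝕜 := ℝ) g f
  simpa using h

theorem L2.norm_sq_eq (f : K.L2) : ‖f‖ ^ 2 = ∑' σ, f σ ^ 2 := by
  rw [← real_inner_self_eq_norm_sq, L2.inner_eq]
  simp only [sq]

theorem L2.summable_sq (f : K.L2) : Summable fun σ => f σ ^ 2 := by
  simpa only [sq] using L2.summable_mul f f

theorem L2.sum_sq_le (f : K.L2) (s : Finset K.Simplex) : ∑ σ ∈ s, f σ ^ 2 ≤ ‖f‖ ^ 2 := by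
  rw [L2.norm_sq_eq]
  exact (L2.summable_sq f).sum_le_tsum s fun _ _ => sq_nonneg _

theorem dense_finSupp : Dense (K.finSupp : Set K.L2) := by
  classical
  intro f
  refine mem_closure_of_tendsto (lp.hasSum_single (p := 2) (by norm_num) f)
    (Eventually.of_forall fun s => K.finSupp.sum_mem fun σ _ => ?_)
  change (Function.support _).Finite
  rw [lp.coeFn_single]
  exact (Set.finite_singleton σ).subset Pi.support_single_subset

variable [hK : K.LocallyFinite] {δ : K.Coboundary} {k : Kind}

namespace Coboundary

theorem form_zero_right (ω : K.Simplex → ℝ) : δ.form k ω 0 = 0 := by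
  simp [form]

/-- Finite energy matters here: a divergent `tsum` would take the value `0` and bound nothing. -/
theorem sum_sq_le_form {ω : K.L2} (hω : ω ∈ δ.neumannDomain k) (s : Finset K.Simplex) :
    ∑ σ ∈ s, δ.firstOrder k ω σ ^ 2 ≤ δ.form k ω ω := by
  have h := (form_summable hω hω).sum_le_tsum s fun σ _ => mul_self_nonneg _
  simpa only [sq, form] using h

theorem form_eq_tsum_formalLaplacian (ω : K.Simplex → ℝ) {φ : K.Simplex → ℝ}
    (hφ : (Function.support φ).Finite) :
    δ.form k ω φ = ∑' σ, ω σ * δ.formalLaplacian k φ σ :=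
  δ.tsum_firstOrder_mul k ω (δ.finite_support_firstOrder k hφ)

namespace ClosedForm

variable (Q : δ.ClosedForm k)

theorem finSupp_le_dom : K.finSupp ≤ Q.dom := by
  intro φ hφ
  refine Q.dirichlet_le ⟨memℓp_of_finite_support (δ.finite_support_firstOrder k hφ), ?_⟩
  intro ε hε
  refine ⟨φ, hφ, ?_⟩
  rw [sub_self, lp.coeFn_zero, form_zero_right, norm_zero]
  simpa using hε

/-- Density of `F^c` in `ℓ²` makes the graph single-valued, so that `toLinearPMap` really has this
graph. -/
theorem eq_zero_of_mem_graph (p : K.L2 × K.L2) (hp : p ∈ Q.graph) (h0 : p.1 = 0) : p.2 = 0 := by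
  refine dense_finSupp.eq_zero_of_inner_right ℝ fun φ hφ => ?_
  rw [← hp.2 φ (Q.finSupp_le_dom hφ), h0, lp.coeFn_zero, form_zero_right]

theorem graph_laplacian : Q.laplacian.graph = Q.graph :=
  Q.graph.toLinearPMap_graph_eq fun p hp h0 => Q.eq_zero_of_mem_graph p hp h0

theorem mem_domain_of_mem_graph {η h : K.L2} (hη : (η, h) ∈ Q.graph) :
    ∃ hd : η ∈ Q.laplacian.domain, Q.laplacian ⟨η, hd⟩ = h := by
  rw [← Q.graph_laplacian, LinearPMap.mem_graph_iff] at hη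
  obtain ⟨y, rfl, hy⟩ := hη
  exact ⟨y.2, hy⟩

theorem inner_laplacian {ω : K.L2} (hω : ω ∈ Q.dom) (η : Q.laplacian.domain) :
    ⟪ω, Q.laplacian η⟫_ℝ = δ.form k ω (η : K.L2) := by
  have h := Q.laplacian.mem_graph η
  rw [Q.graph_laplacian] at h
  exact (h.2 ω hω).symm

theorem formalLaplacian_mem_graph {φ : K.L2} (hφ : φ ∈ K.finSupp) :
    (φ, L2.ofFiniteSupport _ (δ.finite_support_formalLaplacian k hφ)) ∈ Q.graph := by
  refine ⟨Q.finSupp_le_dom hφ, fun ω _ => ?_⟩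
  rw [L2.inner_eq]
  exact form_eq_tsum_formalLaplacian _ hφ

theorem finSupp_le_domain : K.finSupp ≤ Q.laplacian.domain := fun _ hφ =>
  (Q.mem_domain_of_mem_graph (Q.formalLaplacian_mem_graph hφ)).1

theorem laplacianC_domain : Q.laplacianC.domain = K.finSupp :=
  inf_eq_left.2 Q.finSupp_le_domain

theorem laplacianC_apply (φ : Q.laplacianC.domain) :
    (Q.laplacianC φ : K.Simplex → ℝ) = δ.formalLaplacian k (φ : K.L2) := by
  have hφ : (φ : K.L2) ∈ K.finSupp := Q.laplacianC_domain ▸ φ.2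
  obtain ⟨hd, h⟩ := Q.mem_domain_of_mem_graph (Q.formalLaplacian_mem_graph hφ)
  have h1 : Q.laplacianC φ = Q.laplacian ⟨(φ : K.L2), hd⟩ := LinearPMap.domRestrict_apply rfl
  rw [h1, h]
  rfl

/-- The hypothesis mentions neither the kind nor `Q`. A vector orthogonal to the range of `Δ_c + c`,
tested on point masses, satisfies the pointwise equation `A*A u = -c u`, and since `c ≠ 0` this
passes to the Hodge Laplacian. -/
theorem isEssentiallySelfAdjoint_of_forall {c : ℝ} (hc : 0 < c)
    (h : ∀ u : K.L2, δ.formalLaplacian .hodge u = (-c) • (u : K.Simplex → ℝ) → u = 0) :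
    Q.laplacianC.IsEssentiallySelfAdjoint := by
  classical
  have hmem : ∀ φ : Q.laplacianC.domain, (φ : K.L2) ∈ K.finSupp := fun φ =>
    Q.laplacianC_domain ▸ φ.2
  have hin : ∀ (u : K.L2) (φ : Q.laplacianC.domain),
      ⟪u, Q.laplacianC φ⟫_ℝ = δ.form k u (φ : K.L2) := fun u φ => by
    rw [L2.inner_eq, form_eq_tsum_formalLaplacian _ (hmem φ), Q.laplacianC_apply]
  refine LinearPMap.isEssentiallySelfAdjoint_of_ker
    (by rw [Q.laplacianC_domain]; exact dense_finSupp) ?_ ?_ hc ?_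
  · intro φ ψ
    rw [hin, real_inner_comm, hin]
    exact tsum_congr fun σ => mul_comm _ _
  · intro φ
    rw [real_inner_comm, hin]
    exact tsum_nonneg fun σ => mul_self_nonneg _
  · intro u hu
    refine h u (δ.formalLaplacian_hodge_eq_smul k (neg_ne_zero.2 hc.ne') ?_)
    funext σ
    have hf : (Function.support (Pi.single σ (1 : ℝ) : K.Simplex → ℝ)).Finite :=
      (Set.finite_singleton σ).subset Pi.support_single_subset
    let φ : Q.laplacianC.domain :=
      ⟨L2.ofFiniteSupport _ hf, by rw [Q.laplacianC_domain]; exact hf⟩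
    have h1 := hu φ
    rw [inner_add_left, real_inner_comm, hin, form_eq_tsum_formalLaplacian _ (hmem φ),
      real_inner_smul_left, L2.inner_eq] at h1
    change (∑' τ, u τ * δ.formalLaplacian k (Pi.single σ 1) τ)
      + c * ∑' τ, (Pi.single σ (1 : ℝ) : K.Simplex → ℝ) τ * u τ = 0 at h1
    rw [← δ.tsum_formalLaplacian_mul k _ hf, tsum_eq_single σ fun τ hτ => by simp [hτ],
      tsum_eq_single σ fun τ hτ => by simp [hτ]] at h1
    simp only [Pi.single_eq_same, mul_one, one_mul] at h1
    simp only [Pi.smul_apply, smul_eq_mul]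
    linarith

/-! ### Boundedness -/

theorem form_self_le_of_isBoundedOp (hQ : Q.laplacian.IsBoundedOp) :
    ∃ C : ℝ, ∀ φ ∈ K.finSupp, δ.form k φ φ ≤ C * ‖φ‖ ^ 2 := by
  obtain ⟨-, C, hC⟩ := hQ
  refine ⟨C, fun φ hφ => ?_⟩
  have h := Q.inner_laplacian (Q.finSupp_le_dom hφ) ⟨φ, Q.finSupp_le_domain hφ⟩
  rw [← h, sq, ← mul_assoc, mul_comm]
  exact (real_inner_le_norm _ _).trans
    ((mul_le_mul_of_nonneg_left (hC _) (norm_nonneg _)).trans_eq rfl) |>.trans_eq (by ring)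

/-- A bounded `A` makes the form norm continuous on `ℓ²`, so density of `F^c` already gives `Q_D =
ℓ²`. Every admissible form is then the same, and its operator is `A* A`. -/
theorem isBoundedOp_of_clm (A : K.L2 →L[ℝ] K.L2)
    (hA : ∀ ω : K.L2, (A ω : K.Simplex → ℝ) = δ.firstOrder k ω) : Q.laplacian.IsBoundedOp := by
  have hN : ∀ ω : K.L2, ω ∈ δ.neumannDomain k := fun ω => by
    change Memℓp _ 2
    rw [← hA]
    exact lp.memℓp _
  have hform : ∀ ω η : K.L2, δ.form k ω η = ⟪A ω, A η⟫_ℝ := fun ω η => by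
    rw [L2.inner_eq, hA, hA]; rfl
  have hdom : ∀ ω : K.L2, ω ∈ Q.dom := by
    intro ω
    refine Q.dirichlet_le ⟨hN ω, fun ε hε => ?_⟩
    have hcont : Continuous fun φ : K.L2 => δ.form k (ω - φ : K.L2) (ω - φ : K.L2)
        + ‖ω - φ‖ ^ 2 := by
      simp only [hform]
      fun_prop
    have hopen : IsOpen {φ : K.L2 | δ.form k (ω - φ : K.L2) (ω - φ : K.L2) + ‖ω - φ‖ ^ 2 < ε} :=
      isOpen_lt hcont continuous_const
    obtain ⟨φ, hφ, hφ'⟩ := dense_finSupp.inter_open_nonempty _ hopen ⟨ω, by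
      rw [Set.mem_ofPred_eq, sub_self, lp.coeFn_zero, form_zero_right, norm_zero]
      simpa using hε⟩
    exact ⟨φ, hφ', hφ⟩
  have hgraph : ∀ η : K.L2, (η, A.adjoint (A η)) ∈ Q.graph := fun η =>
    ⟨hdom η, fun ω _ => by rw [hform, ContinuousLinearMap.adjoint_inner_right]⟩
  refine ⟨eq_top_iff.2 fun η _ => (Q.mem_domain_of_mem_graph (hgraph η)).1,
    ‖A.adjoint ∘L A‖, fun η => ?_⟩
  obtain ⟨hd, h⟩ := Q.mem_domain_of_mem_graph (hgraph η)
  have h' : Q.laplacian η = A.adjoint (A (η : K.L2)) := h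
  rw [h']
  exact (A.adjoint ∘L A).le_opNorm _

end ClosedForm

end Coboundary

end AbstractSimplicialComplex

namespace AbstractSimplicialComplex

variable {V : Type*} {K : AbstractSimplicialComplex V}

/-! ### Degrees and numbers of cofaces -/

theorem Simplex.mem_faces {σ : K.Simplex} (h : σ.1.Nonempty) : σ.1 ∈ K.faces :=
  σ.2.resolve_right fun h0 => h.ne_empty h0.1

theorem mem_faces_of_subset {σ : K.Simplex} {t : Finset V} (ht : t.Nonempty) (h : t ⊆ σ.1) :
    t ∈ K.faces :=
  (K.isRelLowerSet_faces (Simplex.mem_faces (ht.mono h))).2 h ht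

variable (K) in
/-- A vertex as a simplex. -/
def vertexSimplex (v : V) : K.Simplex := ⟨{v}, Or.inl (K.singleton_mem v)⟩

theorem isFace_vertexSimplex {v : V} {e : K.Simplex} :
    IsFace (K.vertexSimplex v) e ↔ e.1.card = 2 ∧ v ∈ e.1 := by
  unfold IsFace vertexSimplex
  simp [and_comm]

theorem card_faceFinset_le (hdim : K.FiniteDimensional) :
    ∃ n : ℕ, ∀ σ : K.Simplex, (faceFinset σ).card ≤ n := by
  classical
  obtain ⟨N, hN⟩ := hdim
  -- A crude count of all subsets; only uniformity in `σ` is used.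
  refine ⟨2 ^ (N + 1), fun σ => ?_⟩
  have h1 : (faceFinset σ).card ≤ σ.1.powerset.card :=
    Finset.card_le_card_of_injOn (fun τ => τ.1)
      (fun τ hτ => Finset.mem_powerset.2 (mem_faceFinset.1 hτ).1) fun a _ b _ h => Subtype.ext h
  rw [Finset.card_powerset] at h1
  refine h1.trans (Nat.pow_le_pow_right two_pos ?_)
  rcases σ.2 with h | h
  · exact hN _ h
  · rw [h.1]; simp

/-- Schur test: Cauchy–Schwarz in each row costs `n`, and after exchanging the sums each `ω y ^ 2`
is counted at most `D` times. -/
theorem sum_sq_sum_mul_le {θ : K.Simplex → K.Simplex → ℝ} (hθ : ∀ x y, |θ x y| ≤ 1)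
    {r c : K.Simplex → Finset K.Simplex} (h : ∀ x y, y ∈ r x ↔ x ∈ c y) {n D : ℕ}
    (hr : ∀ x, (r x).card ≤ n) (hc : ∀ y, (c y).card ≤ D) (ω : K.L2) (s : Finset K.Simplex) :
    ∑ x ∈ s, (∑ y ∈ r x, ω y * θ x y) ^ 2 ≤ n * D * ‖ω‖ ^ 2 := by
  classical
  calc ∑ x ∈ s, (∑ y ∈ r x, ω y * θ x y) ^ 2
      ≤ ∑ x ∈ s, n * ∑ y ∈ r x, ω y ^ 2 := by
        refine Finset.sum_le_sum fun x _ => sq_sum_le_card_mul_sum_sq.trans ?_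
        refine mul_le_mul (by exact_mod_cast hr x) (Finset.sum_le_sum fun y _ => ?_)
          (Finset.sum_nonneg fun _ _ => sq_nonneg _) (Nat.cast_nonneg _)
        rw [mul_pow]
        exact mul_le_of_le_one_right (sq_nonneg _) ((sq_le_one_iff_abs_le_one _).2 (hθ x y))
    _ = n * ∑ y ∈ s.biUnion r, ∑ x ∈ s.filter (fun x => y ∈ r x), ω y ^ 2 := by
        rw [← Finset.mul_sum]
        congr 1
        refine Finset.sum_comm' fun x y => ?_
        simp only [Finset.mem_filter, Finset.mem_biUnion]
        exact ⟨fun h => ⟨h, x, h⟩, fun h => h.1⟩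
    _ ≤ n * ∑ y ∈ s.biUnion r, D * ω y ^ 2 := by
        refine mul_le_mul_of_nonneg_left (Finset.sum_le_sum fun y _ => ?_) (Nat.cast_nonneg _)
        rw [Finset.sum_const, nsmul_eq_mul]
        refine mul_le_mul_of_nonneg_right ?_ (sq_nonneg _)
        exact_mod_cast (Finset.card_le_card fun x hx =>
          (h x y).1 (Finset.mem_filter.1 hx).2).trans (hc y)
    _ ≤ n * D * ‖ω‖ ^ 2 := by
        rw [← Finset.mul_sum, ← mul_assoc]
        exact mul_le_mul_of_nonneg_left (L2.sum_sq_le ω _) (by positivity)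

theorem exists_clm_of_sum_sq_le (T : (K.Simplex → ℝ) →ₗ[ℝ] (K.Simplex → ℝ)) {C : ℝ}
    (hC : 0 ≤ C)
    (hT : ∀ (ω : K.L2) (s : Finset K.Simplex), ∑ x ∈ s, T ω x ^ 2 ≤ C * ‖ω‖ ^ 2) :
    ∃ A : K.L2 →L[ℝ] K.L2, ∀ ω : K.L2, (A ω : K.Simplex → ℝ) = T ω := by
  have hmem : ∀ ω : K.L2, Memℓp (T ω) 2 := fun ω => memℓp_gen' (C := C * ‖ω‖ ^ 2) fun s => by
    simpa using hT ω s
  let A : K.L2 →ₗ[ℝ] K.L2 :=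
    { toFun := fun ω => ⟨T ω, hmem ω⟩
      map_add' := fun ω η => Subtype.ext (by simp only [lp.coeFn_add, map_add]; rfl)
      map_smul' := fun a ω => Subtype.ext (by simp only [lp.coeFn_smul, map_smul]; rfl) }
  refine ⟨A.mkContinuous √C fun ω => ?_, fun ω => rfl⟩
  rw [← Real.sqrt_sq (norm_nonneg ω), ← Real.sqrt_mul hC]
  refine Real.le_sqrt_of_sq_le ?_
  rw [L2.norm_sq_eq]
  exact (L2.summable_sq _).tsum_le_of_sum_le fun s => hT ω s

/-! ### Bounded degree and bounded Laplacians -/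

variable [hK : K.LocallyFinite]

theorem deg_eq (v : V) : K.deg v = (cofaceFinset (K.vertexSimplex v)).card := by
  rw [deg, ← Set.ncard_coe_finset]
  congr 1
  ext e
  simp [isFace_vertexSimplex]

/-- A coface adds one vertex `b` to `τ` and is recovered as `τ ∪ {v, b}` from the edge `{v, b}`, so
there are no more cofaces than edges at `v`. -/
theorem card_cofaceFinset_le_deg {τ : K.Simplex} {v : V} (hv : v ∈ τ.1) :
    (cofaceFinset τ).card ≤ K.deg v := by
  classical
  rw [deg_eq]
  have h1 : (cofaceFinset τ).image (fun σ => σ.1)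
      ⊆ (cofaceFinset (K.vertexSimplex v)).image fun e => τ.1 ∪ e.1 := by
    intro s hs
    obtain ⟨σ, hσ, rfl⟩ := Finset.mem_image.1 hs
    rw [mem_cofaceFinset] at hσ
    obtain ⟨b, hb, hbτ⟩ : ∃ b ∈ σ.1, b ∉ τ.1 := by
      by_contra! hcon
      have := Finset.card_le_card hcon
      have := hσ.2
      omega
    have hvb : v ≠ b := fun h => hbτ (h ▸ hv)
    have hsub : ({v, b} : Finset V) ⊆ σ.1 := by
      intro x hx
      rcases Finset.mem_insert.1 hx with rfl | hx
      · exact hσ.1 hv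
      · rw [Finset.mem_singleton.1 hx]; exact hb
    obtain ⟨e, he⟩ : ∃ e : K.Simplex, e.1 = {v, b} :=
      ⟨⟨{v, b}, Or.inl (mem_faces_of_subset (by simp) hsub)⟩, rfl⟩
    refine Finset.mem_image.2 ⟨e, ?_, ?_⟩
    · rw [mem_cofaceFinset, isFace_vertexSimplex, he]
      exact ⟨Finset.card_pair hvb, by simp⟩
    · rw [he]
      refine Finset.eq_of_subset_of_card_le (Finset.union_subset hσ.1 hsub) ?_
      have h2 : (insert b τ.1).card ≤ (τ.1 ∪ {v, b}).card :=
        Finset.card_le_card (Finset.insert_subset (by simp) Finset.subset_union_left)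
      rw [Finset.card_insert_of_notMem hbτ] at h2
      have := hσ.2
      omega
  rw [← Finset.card_image_of_injective (cofaceFinset τ) (f := fun σ : K.Simplex => σ.1)
    fun a b h => Subtype.ext h]
  exact (Finset.card_le_card h1).trans Finset.card_image_le

theorem card_cofaceFinset_le {C : ℕ} (hC : ∀ v, K.deg v ≤ C) :
    ∃ D : ℕ, ∀ τ : K.Simplex, (cofaceFinset τ).card ≤ D := by
  -- The empty simplex contains no vertex whose degree could bound its cofaces; their finite number
  -- enters the maximum separately.
  by_cases h : ∃ τ₀ : K.Simplex, τ₀.1 = ∅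
  · obtain ⟨τ₀, h₀⟩ := h
    refine ⟨max C (cofaceFinset τ₀).card, fun τ => ?_⟩
    rcases τ.1.eq_empty_or_nonempty with h | ⟨v, hv⟩
    · rw [show τ = τ₀ from Subtype.ext (h.trans h₀.symm)]
      exact le_max_right _ _
    · exact ((card_cofaceFinset_le_deg hv).trans (hC v)).trans (le_max_left _ _)
  · refine ⟨C, fun τ => ?_⟩
    obtain ⟨v, hv⟩ := Finset.nonempty_iff_ne_empty.2 fun h0 => h ⟨τ, h0⟩
    exact (card_cofaceFinset_le_deg hv).trans (hC v)

namespace Coboundary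

variable {δ : K.Coboundary}

theorem exists_clm_firstOrder (δ : K.Coboundary) (k : Kind) (hdim : K.FiniteDimensional) {C : ℕ}
    (hC : ∀ v, K.deg v ≤ C) :
    ∃ A : K.L2 →L[ℝ] K.L2, ∀ ω : K.L2, (A ω : K.Simplex → ℝ) = δ.firstOrder k ω := by
  obtain ⟨n, hn⟩ := card_faceFinset_le hdim
  obtain ⟨D, hD⟩ := card_cofaceFinset_le hC
  obtain ⟨A, hA⟩ := exists_clm_of_sum_sq_le δ.toLin (C := n * D) (by positivity) fun ω s => by
    simp only [toLin_apply]
    exact sum_sq_sum_mul_le (θ := fun x y => δ.sign y x) (fun x y => δ.abs_sign_le_one y x)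
      (c := cofaceFinset) (by simp) hn hD ω s
  obtain ⟨B, hB⟩ := exists_clm_of_sum_sq_le δ.boundary (C := D * n) (by positivity) fun ω s => by
    simp only [boundary_apply]
    exact sum_sq_sum_mul_le (θ := fun x y => δ.sign x y) (fun x y => δ.abs_sign_le_one x y)
      (c := faceFinset) (by simp) hD hn ω s
  cases k with
  | up => exact ⟨A, hA⟩
  | down => exact ⟨B, hB⟩
  | hodge => exact ⟨A + B, fun ω => by
      rw [add_apply, lp.coeFn_add, hA, hB]; rfl⟩

theorem sum_sq_firstOrder_vertex [DecidableEq K.Simplex] (δ : K.Coboundary) {k : Kind}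
    (hk : k ≠ .down) (v : V) :
    ∑ σ ∈ cofaceFinset (K.vertexSimplex v),
      δ.firstOrder k (Pi.single (K.vertexSimplex v) 1) σ ^ 2 = K.deg v := by
  have h1 : ∀ σ ∈ cofaceFinset (K.vertexSimplex v),
      δ.firstOrder k (Pi.single (K.vertexSimplex v) 1) σ ^ 2 = 1 := by
    intro σ hσ
    rw [mem_cofaceFinset] at hσ
    have hb : δ.boundary (Pi.single (K.vertexSimplex v) 1) σ = 0 := by
      rw [boundary_apply]
      refine Finset.sum_eq_zero fun τ hτ => ?_
      rw [mem_cofaceFinset] at hτ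
      have hne : τ ≠ K.vertexSimplex v := by
        rintro rfl
        have := hσ.2
        have := hτ.2
        omega
      rw [Pi.single_eq_of_ne hne, zero_mul]
    cases k with
    | down => exact absurd rfl hk
    | up => exact (sq _).trans (by
        rw [firstOrder, toLin_single]; exact δ.sign_mul_self hσ)
    | hodge => exact (sq _).trans (by
        rw [firstOrder, LinearMap.add_apply, Pi.add_apply, hb, add_zero, toLin_single]
        exact δ.sign_mul_self hσ)
  rw [Finset.sum_congr rfl h1, deg_eq]
  simp

theorem ClosedForm.isBoundedOp_iff {k : Kind} (Q : δ.ClosedForm k)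
    (hdim : K.FiniteDimensional) :
    Q.laplacian.IsBoundedOp ↔ ∃ C : ℕ, ∀ v, K.deg v ≤ C := by
  classical
  constructor
  · intro hQ
    obtain ⟨C, hC⟩ := Q.form_self_le_of_isBoundedOp hQ
    refine ⟨⌈C⌉₊, fun v => ?_⟩
    suffices h : (K.deg v : ℝ) ≤ C from by exact_mod_cast h.trans (Nat.le_ceil C)
    have hform : ∀ φ ∈ K.finSupp, ∀ s : Finset K.Simplex,
        ∑ σ ∈ s, δ.firstOrder k φ σ ^ 2 ≤ C * ‖φ‖ ^ 2 := fun φ hφ s =>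
      (sum_sq_le_form (Q.le_neumann (Q.finSupp_le_dom hφ)) s).trans (hC φ hφ)
    by_cases hk : k = .down
    · subst hk
      -- For `∂` a vertex indicator need not see the degree. The signed sum of the edges at `v` has
      -- squared norm `deg v` and boundary `deg v` at `v`, whence `(deg v)² ≤ C deg v`.
      let f : K.Simplex → ℝ := δ.sign (K.vertexSimplex v)
      have hsupp : ∀ σ, σ ∉ cofaceFinset (K.vertexSimplex v) → f σ = 0 := fun σ hσ =>
        δ.sign_eq_zero (by simpa using hσ)
      have hf : (Function.support f).Finite :=
        (cofaceFinset (K.vertexSimplex v)).finite_toSet.subset fun σ hσ => by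
          by_contra h; exact hσ (hsupp σ h)
      have hsum : ∑ σ ∈ cofaceFinset (K.vertexSimplex v), f σ * f σ = K.deg v := by
        rw [Finset.sum_congr rfl fun σ hσ => δ.sign_mul_self (mem_cofaceFinset.1 hσ), deg_eq]
        simp
      have hnorm : ‖L2.ofFiniteSupport f hf‖ ^ 2 = K.deg v := by
        rw [L2.norm_sq_eq, L2.coe_ofFiniteSupport,
          tsum_eq_sum (s := cofaceFinset (K.vertexSimplex v)) fun σ hσ => by simp [hsupp σ hσ]]
        simpa only [sq] using hsum
      have h := hform _ (L2.ofFiniteSupport_mem f hf) {K.vertexSimplex v}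
      rw [Finset.sum_singleton, hnorm, L2.coe_ofFiniteSupport, firstOrder, boundary_apply,
        hsum, sq] at h
      rcases (Nat.cast_nonneg (α := ℝ) (K.deg v)).eq_or_lt with h0 | h0
      -- If `deg v = 0` nothing can be cancelled, and `0 ≤ C` comes from testing with the indicator
      -- of `v`.
      · rw [← h0]
        have hf1 : (Function.support (Pi.single (K.vertexSimplex v) (1 : ℝ) :
            K.Simplex → ℝ)).Finite := (Set.finite_singleton _).subset Pi.support_single_subset
        have h2 := hform _ (L2.ofFiniteSupport_mem _ hf1) ∅
        rw [Finset.sum_empty, L2.norm_sq_eq, L2.coe_ofFiniteSupport,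
          tsum_eq_single (K.vertexSimplex v) fun σ hσ => by simp [hσ]] at h2
        simpa using h2
      · exact le_of_mul_le_mul_right h h0
    · have hf1 : (Function.support (Pi.single (K.vertexSimplex v) (1 : ℝ) :
          K.Simplex → ℝ)).Finite := (Set.finite_singleton _).subset Pi.support_single_subset
      have h2 := hform _ (L2.ofFiniteSupport_mem _ hf1) (cofaceFinset (K.vertexSimplex v))
      rw [L2.coe_ofFiniteSupport, δ.sum_sq_firstOrder_vertex hk, L2.norm_sq_eq,
        L2.coe_ofFiniteSupport,
        tsum_eq_single (K.vertexSimplex v) fun σ hσ => by simp [hσ]] at h2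
      simpa using h2
  · rintro ⟨C, hC⟩
    obtain ⟨A, hA⟩ := δ.exists_clm_firstOrder k hdim hC
    exact Q.isBoundedOp_of_clm A hA

end Coboundary

end AbstractSimplicialComplex

/-! ### Maximum principle and localization. -/

namespace AbstractSimplicialComplex

variable {V : Type*} {K : AbstractSimplicialComplex V}

namespace L2

/-- Square summability makes `u` tend to zero along the cofinite filter, so only finitely many
points compete with a given nonzero value. -/
theorem exists_forall_abs_le (u : K.L2) (hu : u ≠ 0) :
    ∃ x, u x ≠ 0 ∧ ∀ y, |u y| ≤ |u x| := by
  obtain ⟨x₀, hx₀⟩ : ∃ x, u x ≠ 0 := by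
    by_contra! h
    exact hu (lp.ext (funext h))
  have hlim := (L2.summable_sq u).tendsto_cofinite_zero
  have hfin : {y | u x₀ ^ 2 ≤ u y ^ 2}.Finite := by
    have h := hlim.eventually (gt_mem_nhds (sq_pos_of_ne_zero hx₀))
    simpa [Filter.eventually_cofinite] using h
  obtain ⟨x, hx, hmax⟩ := Set.exists_max_image _ (fun y => u y ^ 2) hfin ⟨x₀, by simp⟩
  have hx' : u x₀ ^ 2 ≤ u x ^ 2 := hx
  refine ⟨x, fun h0 => ?_, fun y => ?_⟩
  · rw [h0] at hx'
    have := sq_pos_of_ne_zero hx₀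
    norm_num at hx'
    exact hx₀ hx'
  · rw [← sq_le_sq]
    by_cases hy : u x₀ ^ 2 ≤ u y ^ 2
    · exact hmax y hy
    · exact (not_le.1 hy).le.trans hx'

end L2

theorem bHodge_nonneg (x y : K.Simplex) : 0 ≤ bHodge x y := abs_nonneg _

variable [hK : K.LocallyFinite]

theorem bHodge_eq_zero {x y : K.Simplex} (h : y ∉ nbhd x) : bHodge x y = 0 := by
  have hU : ¬ ∃ σ, IsFace x σ ∧ IsFace y σ := fun ⟨σ, hx, hy⟩ =>
    h (Coboundary.faceFinset_subset_nbhd hx (mem_faceFinset.2 hy))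
  have hD : ¬ ∃ ρ, IsFace ρ x ∧ IsFace ρ y := fun ⟨ρ, hx, hy⟩ =>
    h (Coboundary.cofaceFinset_subset_nbhd hx (mem_cofaceFinset.2 hy))
  rw [bHodge, bUp_eq_zero hU, bDown_eq_zero hD, sub_self, abs_zero]

theorem sum_bHodge_le_tsum (x : K.Simplex) (F : Finset K.Simplex) :
    ∑ y ∈ F, bHodge x y ≤ ∑' y, bHodge x y :=
  (summable_of_ne_finset_zero fun _ hy => bHodge_eq_zero hy).sum_le_tsum F
    fun y _ => bHodge_nonneg x y

theorem Coboundary.formanCurvature_eq (δ : K.Coboundary) (x : K.Simplex) :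
    formanCurvature x = δ.hodgeKernel x x - ∑' y, bHodge x y := by
  rw [δ.hodgeKernel_self, formanCurvature, ← Set.ncard_coe_finset, ← Set.ncard_coe_finset,
    add_comm (Set.ncard _ : ℝ)]
  congr 4 <;> ext <;> simp

/-- Maximum principle: for a Forman curvature bounded from below, a sufficiently negative number is
not an `ℓ²` eigenvalue. -/
theorem Coboundary.eq_zero_of_formanCurvature {δ : K.Coboundary} {b c : ℝ}
    (hb : ∀ τ : K.Simplex, b ≤ formanCurvature τ) (hc : 0 < b + c) {u : K.L2}
    (hu : δ.formalLaplacian .hodge u = (-c) • (u : K.Simplex → ℝ)) : u = 0 := by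
  classical
  by_contra hne
  obtain ⟨x, hx, hmax⟩ := L2.exists_forall_abs_le u hne
  have h1 := congrFun hu x
  rw [δ.formalLaplacian_hodge_apply (u : K.Simplex → ℝ) (Finset.subset_insert x (nbhd x)),
    ← Finset.add_sum_erase _ _ (Finset.mem_insert_self x _), Pi.smul_apply, smul_eq_mul] at h1
  set N := (insert x (nbhd x)).erase x
  have h2 : |∑ y ∈ N, δ.hodgeKernel x y * u y| ≤ (∑' y, bHodge x y) * |u x| :=
    calc |∑ y ∈ N, δ.hodgeKernel x y * u y| ≤ ∑ y ∈ N, bHodge x y * |u x| := by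
          refine (Finset.abs_sum_le_sum_abs _ _).trans (Finset.sum_le_sum fun y hy => ?_)
          rw [abs_mul, δ.abs_hodgeKernel (Finset.ne_of_mem_erase hy).symm]
          exact mul_le_mul_of_nonneg_left (hmax y) (bHodge_nonneg x y)
      _ ≤ (∑' y, bHodge x y) * |u x| := by
          rw [← Finset.sum_mul]
          exact mul_le_mul_of_nonneg_right (sum_bHodge_le_tsum x N) (abs_nonneg _)
  -- At the maximum point the equation equates the off-diagonal sum with `-(diagonal + c) u x`;
  -- dividing by `|u x|` bounds `diagonal + c` by `∑ b^H`, which contradicts `b + c > 0`.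
  have h3 : ∑ y ∈ N, δ.hodgeKernel x y * u y = -((δ.hodgeKernel x x + c) * u x) := by
    linear_combination h1
  have h4 := hb x
  rw [δ.formanCurvature_eq] at h4
  rw [h3, abs_neg, abs_mul] at h2
  have h5 := le_of_mul_le_mul_right h2 (abs_pos.2 hx)
  have h6 := le_abs_self (δ.hodgeKernel x x + c)
  linarith

/-- Localization: an `ℓ²` eigenfunction to a negative eigenvalue is controlled by the energy of
cutoff functions. -/
theorem Coboundary.mul_sum_sq_le (δ : K.Coboundary) {c ε : ℝ} {u : K.L2}
    (hu : δ.formalLaplacian .hodge u = (-c) • (u : K.Simplex → ℝ)) {χ : K.Simplex → ℝ}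
    (hχ : (Function.support χ).Finite)
    (hε : ∀ (x : K.Simplex) (F : Finset K.Simplex),
      ∑ y ∈ F, |δ.hodgeKernel x y| * (χ x - χ y) ^ 2 ≤ ε) (hε0 : 0 ≤ ε) :
    c * ∑ x ∈ hχ.toFinset, χ x ^ 2 * u x ^ 2 ≤ ε / 2 * ‖u‖ ^ 2 := by
  classical
  set S := hχ.toFinset with hS
  -- `F` contains every neighbour of the support of `χ`, so the eigenvalue equation on `S` involves
  -- only entries inside `F`.
  set F := S ∪ S.biUnion nbhd with hF
  have hχ0 : ∀ x, x ∉ S → χ x = 0 := fun x hx => by simpa [hS] using hx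
  have hA : ∑ x ∈ F, ∑ y ∈ F, δ.hodgeKernel x y * (u x * u y) * χ x ^ 2
      = -c * ∑ x ∈ S, χ x ^ 2 * u x ^ 2 := by
    rw [Finset.mul_sum, ← Finset.sum_subset (Finset.subset_union_left (s₂ := S.biUnion nbhd))
      fun x _ hx => by simp [hχ0 x hx]]
    refine Finset.sum_congr rfl fun x hx => ?_
    have h1 := congrFun hu x
    rw [δ.formalLaplacian_hodge_apply (u : K.Simplex → ℝ) (F := F)
      ((Finset.subset_biUnion_of_mem nbhd hx).trans Finset.subset_union_right),
      Pi.smul_apply, smul_eq_mul] at h1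
    have h2 : ∑ y ∈ F, δ.hodgeKernel x y * (u x * u y) * χ x ^ 2
        = (∑ y ∈ F, δ.hodgeKernel x y * u y) * (u x * χ x ^ 2) := by
      rw [Finset.sum_mul]
      exact Finset.sum_congr rfl fun y _ => by ring
    rw [h2, h1]
    ring
  have hB : ∑ x ∈ F, ∑ y ∈ F, δ.hodgeKernel x y * (u x * u y) * χ y ^ 2
      = -c * ∑ x ∈ S, χ x ^ 2 * u x ^ 2 := by
    rw [← hA, Finset.sum_comm]
    refine Finset.sum_congr rfl fun x _ => Finset.sum_congr rfl fun y _ => ?_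
    rw [δ.hodgeKernel_symm]
    ring
  have hpos := δ.sum_sum_hodgeKernel_nonneg F fun x => χ x * u x
  have hD : ∑ x ∈ F, ∑ y ∈ F, |δ.hodgeKernel x y| * (χ x - χ y) ^ 2 * u x ^ 2
      ≤ ε * ‖u‖ ^ 2 := by
    calc _ ≤ ∑ x ∈ F, ε * u x ^ 2 := Finset.sum_le_sum fun x _ => by
          rw [← Finset.sum_mul]
          exact mul_le_mul_of_nonneg_right (hε x F) (sq_nonneg _)
      _ ≤ ε * ‖u‖ ^ 2 := by
          rw [← Finset.mul_sum]
          exact mul_le_mul_of_nonneg_left (L2.sum_sq_le u F) hε0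
  have hD' : ∑ x ∈ F, ∑ y ∈ F, |δ.hodgeKernel x y| * (χ x - χ y) ^ 2 * u y ^ 2
      ≤ ε * ‖u‖ ^ 2 := by
    refine le_trans (le_of_eq ?_) hD
    rw [Finset.sum_comm]
    refine Finset.sum_congr rfl fun x _ => Finset.sum_congr rfl fun y _ => ?_
    rw [δ.hodgeKernel_symm]
    ring
  -- Substitute `χ x χ y = (χ x² + χ y²)/2 - (χ x - χ y)²/2` and estimate `|u x u y|` by `(u x² + u
  -- y²)/2` in the error term; the two halves give the factor `1/4`.
  have hE : ∑ x ∈ F, ∑ y ∈ F, δ.hodgeKernel x y * (χ x * u x * (χ y * u y))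
      ≤ ∑ x ∈ F, ∑ y ∈ F, (δ.hodgeKernel x y * (u x * u y) * χ x ^ 2 / 2
        + δ.hodgeKernel x y * (u x * u y) * χ y ^ 2 / 2
        + |δ.hodgeKernel x y| * (χ x - χ y) ^ 2 * u x ^ 2 / 4
        + |δ.hodgeKernel x y| * (χ x - χ y) ^ 2 * u y ^ 2 / 4) := by
    refine Finset.sum_le_sum fun x _ => Finset.sum_le_sum fun y _ => ?_
    set a := δ.hodgeKernel x y
    have h1 : -(a * (u x * u y)) ≤ |a| * ((u x ^ 2 + u y ^ 2) / 2) := by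
      have h2 : |u x * u y| ≤ (u x ^ 2 + u y ^ 2) / 2 := by
        rw [abs_le]
        constructor <;> nlinarith [sq_nonneg (u x - u y), sq_nonneg (u x + u y)]
      calc -(a * (u x * u y)) ≤ |a * (u x * u y)| := neg_le_abs _
        _ = |a| * |u x * u y| := abs_mul _ _
        _ ≤ _ := mul_le_mul_of_nonneg_left h2 (abs_nonneg _)
    have h3 := mul_le_mul_of_nonneg_right h1 (sq_nonneg (χ x - χ y))
    linarith
  simp only [Finset.sum_add_distrib, ← Finset.sum_div] at hE
  rw [hA, hB] at hE
  linarith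

theorem Coboundary.eq_zero_of_cutoff {δ : K.Coboundary} {c : ℝ} (hc : 0 < c)
    (hcut : ∀ x : K.Simplex, ∀ ε > 0, ∃ χ : K.Simplex → ℝ, (Function.support χ).Finite ∧
      χ x = 1 ∧ ∀ (z : K.Simplex) (F : Finset K.Simplex),
        ∑ y ∈ F, |δ.hodgeKernel z y| * (χ z - χ y) ^ 2 ≤ ε) {u : K.L2}
    (hu : δ.formalLaplacian .hodge u = (-c) • (u : K.Simplex → ℝ)) : u = 0 := by
  refine lp.ext (funext fun x => ?_)
  rw [lp.coeFn_zero, Pi.zero_apply]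
  by_contra hx
  have hpos : 0 < c * u x ^ 2 := mul_pos hc (sq_pos_of_ne_zero hx)
  have hd : 0 < ‖u‖ ^ 2 + 1 := by positivity
  -- With this `ε`, localization would give `c u(x)² ≤ c u(x)² / 2`.
  obtain ⟨χ, hχ, hχx, h⟩ := hcut x (c * u x ^ 2 / (‖u‖ ^ 2 + 1)) (by positivity)
  have h1 := δ.mul_sum_sq_le hu hχ h (by positivity)
  have h2 : u x ^ 2 ≤ ∑ y ∈ hχ.toFinset, χ y ^ 2 * u y ^ 2 := by
    have h3 := Finset.single_le_sum (f := fun y => χ y ^ 2 * u y ^ 2)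
      (fun y _ => by positivity) (show x ∈ hχ.toFinset by simp [hχx])
    simpa [hχx] using h3
  have h4 := mul_le_mul_of_nonneg_left h2 hc.le
  have h5 : c * u x ^ 2 / (‖u‖ ^ 2 + 1) / 2 * ‖u‖ ^ 2 ≤ c * u x ^ 2 / 2 := by
    rw [div_div, div_mul_eq_mul_div, div_le_div_iff₀ (by positivity) two_pos]
    nlinarith
  linarith

/-- The energy of a cutoff function, from bounds on its differences along faces and cofaces. -/
theorem Coboundary.sum_abs_hodgeKernel_mul_le (δ : K.Coboundary) {n : ℕ}
    (hn : ∀ σ : K.Simplex, (faceFinset σ).card ≤ n) {x : K.Simplex} {w : K.Simplex → ℝ}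
    (hw : ∀ y, 0 ≤ w y) {M : ℝ} (hM : 0 ≤ M)
    (hup : ∀ σ y, IsFace x σ → IsFace y σ → w y * (cofaceFinset x).card ≤ M)
    (hdown : ∀ ρ y, IsFace ρ x → IsFace ρ y → w y * (cofaceFinset ρ).card ≤ M)
    (F : Finset K.Simplex) : ∑ y ∈ F, |δ.hodgeKernel x y| * w y ≤ 2 * n * M := by
  classical
  have hrow : ∀ (s : K.Simplex → ℝ) (G : Finset K.Simplex), (∀ y, |s y| ≤ 1) →
      (∀ y, y ∉ G → s y = 0) → ∑ y ∈ F, |s y| * w y ≤ ∑ y ∈ G, w y := by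
    intro s G hs h0
    rw [← Finset.sum_filter_of_ne (p := fun y => y ∈ G) fun y _ hy => by
      by_contra hyG; exact hy (by rw [h0 y hyG]; simp)]
    refine (Finset.sum_le_sum fun y _ => mul_le_of_le_one_left (hw y) (hs y)).trans ?_
    exact Finset.sum_le_sum_of_subset_of_nonneg (fun y hy => (Finset.mem_filter.1 hy).2)
      fun y _ _ => hw y
  have h1 : ∀ y ∈ F, |δ.hodgeKernel x y| * w y ≤
      ∑ σ ∈ cofaceFinset x, |δ.sign y σ| * w y + ∑ ρ ∈ faceFinset x, |δ.sign ρ y| * w y := by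
    intro y _
    rw [← Finset.sum_mul, ← Finset.sum_mul, ← add_mul]
    refine mul_le_mul_of_nonneg_right ?_ (hw y)
    refine (abs_add_le _ _).trans (add_le_add ?_ ?_)
    · refine (Finset.abs_sum_le_sum_abs _ _).trans (Finset.sum_le_sum fun σ _ => ?_)
      rw [abs_mul]
      exact mul_le_of_le_one_left (abs_nonneg _) (δ.abs_sign_le_one _ _)
    · refine (Finset.abs_sum_le_sum_abs _ _).trans (Finset.sum_le_sum fun σ _ => ?_)
      rw [abs_mul]
      exact mul_le_of_le_one_left (abs_nonneg _) (δ.abs_sign_le_one _ _)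
  -- Through cofaces, the number of `σ` cancels the denominator of the weight bound and each `σ` has
  -- at most `n` faces. Through faces, at most `n` simplices `ρ` occur, and the number of cofaces of
  -- each `ρ` cancels.
  have hU : ∀ σ ∈ cofaceFinset x, ∑ y ∈ F, |δ.sign y σ| * w y
      ≤ n * (M / (cofaceFinset x).card) := by
    intro σ hσ
    have hpos : (0 : ℝ) < (cofaceFinset x).card := by
      exact_mod_cast Finset.card_pos.2 ⟨σ, hσ⟩
    refine (hrow (fun y => δ.sign y σ) (faceFinset σ) (fun y => δ.abs_sign_le_one _ _)
      fun y hy => δ.sign_eq_zero (by simpa using hy)).trans ?_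
    refine (Finset.sum_le_card_nsmul _ _ (M / (cofaceFinset x).card) fun y hy => ?_).trans ?_
    · exact (le_div_iff₀ hpos).2 (hup σ y (mem_cofaceFinset.1 hσ) (mem_faceFinset.1 hy))
    · rw [nsmul_eq_mul]
      exact mul_le_mul_of_nonneg_right (by exact_mod_cast hn σ) (by positivity)
  have hD : ∀ ρ ∈ faceFinset x, ∑ y ∈ F, |δ.sign ρ y| * w y ≤ M := by
    intro ρ hρ
    have hpos : (0 : ℝ) < (cofaceFinset ρ).card := by
      exact_mod_cast Finset.card_pos.2 ⟨x, mem_cofaceFinset.2 (mem_faceFinset.1 hρ)⟩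
    refine (hrow (fun y => δ.sign ρ y) (cofaceFinset ρ) (fun y => δ.abs_sign_le_one _ _)
      fun y hy => δ.sign_eq_zero (by simpa using hy)).trans ?_
    refine (Finset.sum_le_card_nsmul _ _ (M / (cofaceFinset ρ).card) fun y hy => ?_).trans ?_
    · exact (le_div_iff₀ hpos).2 (hdown ρ y (mem_faceFinset.1 hρ) (mem_cofaceFinset.1 hy))
    · rw [nsmul_eq_mul, mul_div_cancel₀ _ hpos.ne']
  calc ∑ y ∈ F, |δ.hodgeKernel x y| * w y
      ≤ ∑ σ ∈ cofaceFinset x, ∑ y ∈ F, |δ.sign y σ| * w y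
        + ∑ ρ ∈ faceFinset x, ∑ y ∈ F, |δ.sign ρ y| * w y := by
        rw [Finset.sum_comm, Finset.sum_comm (s := faceFinset x), ← Finset.sum_add_distrib]
        exact Finset.sum_le_sum h1
    _ ≤ n * M + n * M := by
        refine add_le_add ((Finset.sum_le_card_nsmul _ _ _ hU).trans ?_)
          ((Finset.sum_le_card_nsmul _ _ _ hD).trans ?_)
        · rw [nsmul_eq_mul, mul_left_comm]
          refine mul_le_mul_of_nonneg_left ?_ (Nat.cast_nonneg _)
          rcases eq_or_ne ((cofaceFinset x).card : ℝ) 0 with h | h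
          · rw [h, zero_mul]; exact hM
          · rw [mul_div_cancel₀ _ h]
        · rw [nsmul_eq_mul]
          exact mul_le_mul_of_nonneg_right (by exact_mod_cast hn x) hM
    _ = 2 * n * M := by ring

end AbstractSimplicialComplex

/-! ### The degree path metric. -/

namespace AbstractSimplicialComplex

variable {V : Type*} {K : AbstractSimplicialComplex V}

variable (K) in
/-- The length of an edge of the 1-skeleton. -/
noncomputable def edgeLength (v w : V) : ℝ := 1 / √(max (K.deg v : ℝ) (K.deg w : ℝ))

theorem edgeLength_comm (v w : V) : K.edgeLength v w = K.edgeLength w v := by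
  rw [edgeLength, max_comm]; rfl

theorem edgeLength_nonneg (v w : V) : 0 ≤ K.edgeLength v w := by
  unfold edgeLength; positivity

theorem degLength_nil (v : V) : K.degLength (.nil : K.oneSkeleton.Walk v v) = 0 := by
  simp [degLength]

theorem degLength_cons {u v w : V} (h : K.oneSkeleton.Adj u v) (p : K.oneSkeleton.Walk v w) :
    K.degLength (.cons h p) = K.edgeLength u v + K.degLength p := by
  simp [degLength, edgeLength]

theorem degLength_nonneg {v w : V} (p : K.oneSkeleton.Walk v w) : 0 ≤ K.degLength p := by
  induction p with
  | nil => rw [degLength_nil]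
  | cons h p ih => rw [degLength_cons]; exact add_nonneg (edgeLength_nonneg _ _) ih

theorem degDist_le {v w : V} (p : K.oneSkeleton.Walk v w) : K.degDist v w ≤ K.degLength p :=
  ciInf_le ⟨0, by rintro _ ⟨q, rfl⟩; exact degLength_nonneg q⟩ p

theorem degDist_le_edgeLength {v w : V} (h : K.oneSkeleton.Adj v w) :
    K.degDist v w ≤ K.edgeLength v w := by
  refine (degDist_le (.cons h .nil)).trans_eq ?_
  rw [degLength_cons, degLength_nil, add_zero]

theorem oneSkeleton_adj_of_mem {σ : K.Simplex} {v w : V} (hv : v ∈ σ.1) (hw : w ∈ σ.1)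
    (hne : v ≠ w) : K.oneSkeleton.Adj v w := by
  classical
  refine ⟨hne, ?_⟩
  convert mem_faces_of_subset (σ := σ) (t := {v, w}) (by simp) ?_
  intro x hx
  rcases Finset.mem_insert.1 hx with rfl | hx
  · exact hv
  · rw [Finset.mem_singleton.1 hx]; exact hw

theorem edgeLength_sq_mul_deg_le (v w : V) : K.edgeLength v w ^ 2 * K.deg v ≤ 1 := by
  rw [edgeLength, div_pow, one_pow, Real.sq_sqrt (by positivity), one_div_mul_eq_div]
  exact div_le_one_of_le₀ (le_max_left _ _) (by positivity)

theorem exists_isFace_of_adj {v w : V} (h : K.oneSkeleton.Adj v w) :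
    ∃ e : K.Simplex, IsFace (K.vertexSimplex v) e ∧ w ∈ e.1 := by
  classical
  obtain ⟨e, he⟩ : ∃ e : K.Simplex, e.1 = {v, w} :=
    ⟨⟨{v, w}, Or.inl (by convert h.2)⟩, rfl⟩
  refine ⟨e, isFace_vertexSimplex.2 ⟨?_, ?_⟩, ?_⟩ <;> rw [he]
  · exact Finset.card_pair h.1
  · simp
  · simp

variable (K) in
/-- The vertices reached from `v` by a path of length at most `s`. -/
def pathBall (v : V) (s : ℝ) : Set V :=
  {w | ∃ p : K.oneSkeleton.Walk v w, K.degLength p ≤ s}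

theorem nonneg_of_infinite_pathBall {v : V} {s : ℝ} (h : (K.pathBall v s).Infinite) : 0 ≤ s := by
  obtain ⟨w, p, hp⟩ := h.nonempty
  exact (degLength_nonneg p).trans hp

/-- Take `v` attaining the larger supremum: its partner satisfies `f w ≤ t.sup f`, so passing to
suprema only shrinks the difference. Values in `NNReal` give the empty supremum the value `0`. -/
theorem sub_sup_sq_mul_le {s t : Finset V} (f : V → NNReal) {D M : ℝ} (hD : 0 ≤ D) (hM : 0 ≤ M)
    (h : ∀ v ∈ s, ∃ w ∈ t, ((f v : ℝ) - f w) ^ 2 * D ≤ M) (hle : t.sup f ≤ s.sup f) :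
    (((s.sup f : NNReal) : ℝ) - (t.sup f : NNReal)) ^ 2 * D ≤ M := by
  rcases s.eq_empty_or_nonempty with rfl | hs
  · rw [Finset.sup_empty, bot_eq_zero, nonpos_iff_eq_zero] at hle
    rw [hle]
    simpa using hM
  · obtain ⟨v, hv, hvs⟩ := Finset.exists_mem_eq_sup s hs f
    obtain ⟨w, hw, hvw⟩ := h v hv
    refine le_trans (mul_le_mul_of_nonneg_right (pow_le_pow_left₀ ?_ ?_ 2) hD) hvw
    · exact sub_nonneg.2 (by exact_mod_cast hle)
    · rw [hvs]
      exact sub_le_sub_left (by exact_mod_cast Finset.le_sup hw) _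

theorem sup_sub_sup_sq_mul_le {s t : Finset V} (f : V → NNReal) {D M : ℝ} (hD : 0 ≤ D)
    (hM : 0 ≤ M) (h : ∀ v ∈ s, ∃ w ∈ t, ((f v : ℝ) - f w) ^ 2 * D ≤ M)
    (h' : ∀ w ∈ t, ∃ v ∈ s, ((f w : ℝ) - f v) ^ 2 * D ≤ M) :
    (((s.sup f : NNReal) : ℝ) - (t.sup f : NNReal)) ^ 2 * D ≤ M := by
  rcases le_total (t.sup f) (s.sup f) with hle | hle
  · exact sub_sup_sq_mul_le f hD hM h hle
  · rw [← neg_sub, neg_sq]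
    exact sub_sup_sq_mul_le f hD hM h' hle

variable [hK : K.LocallyFinite]

theorem finite_adj (v : V) : {w | K.oneSkeleton.Adj v w}.Finite := by
  classical
  refine ((cofaceFinset (K.vertexSimplex v)).biUnion fun e => e.1).finite_toSet.subset
    fun w hw => ?_
  obtain ⟨e, he, hwe⟩ := exists_isFace_of_adj hw
  exact Finset.mem_coe.2 (Finset.mem_biUnion.2 ⟨e, mem_cofaceFinset.2 he, hwe⟩)

theorem edgeLength_pos {v w : V} (h : K.oneSkeleton.Adj v w) : 0 < K.edgeLength v w := by
  obtain ⟨e, he, -⟩ := exists_isFace_of_adj h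
  have h1 : (0 : ℝ) < K.deg v := by
    rw [deg_eq]
    exact_mod_cast Finset.card_pos.2 ⟨e, mem_cofaceFinset.2 he⟩
  have h2 := h1.trans_le (le_max_left (K.deg v : ℝ) (K.deg w))
  unfold edgeLength
  positivity

/-- All vertices of a simplex through `v` are equal or adjacent to `v`, so it is a subset of a
finite closed neighbourhood. -/
theorem finite_simplices_mem (v : V) : {σ : K.Simplex | v ∈ σ.1}.Finite := by
  classical
  refine Set.Finite.of_finite_image (f := fun τ : K.Simplex => τ.1) ?_
    (fun a _ b _ h => Subtype.ext h)
  refine ((insert v (finite_adj (K := K) v).toFinset).powerset.finite_toSet).subset ?_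
  rintro _ ⟨σ, hσ, rfl⟩
  rw [Finset.mem_coe, Finset.mem_powerset]
  intro w hw
  by_cases hne : v = w
  · rw [hne]; exact Finset.mem_insert_self _ _
  · exact Finset.mem_insert_of_mem (by simpa using oneSkeleton_adj_of_mem hσ hw hne)

/-! ### Finiteness of balls in the degree path metric -/

/-- Vertices are isolated in the degree path metric. -/
theorem exists_pos_le_degDist (hconn : K.oneSkeleton.Connected) (v : V) :
    ∃ ε > 0, ∀ w, w ≠ v → ε ≤ K.degDist v w := by
  obtain ⟨ε, hε, h⟩ : ∃ ε > 0, ∀ w, K.oneSkeleton.Adj v w → ε ≤ K.edgeLength v w := by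
    rcases Set.eq_empty_or_nonempty {w | K.oneSkeleton.Adj v w} with h0 | h0
    · refine ⟨1, one_pos, fun w hw => ?_⟩
      have hw' : w ∈ {w | K.oneSkeleton.Adj v w} := hw
      rw [h0] at hw'
      exact hw'.elim
    · obtain ⟨w, hw, hmin⟩ := Set.exists_min_image _ (K.edgeLength v) (finite_adj v) h0
      exact ⟨_, edgeLength_pos hw, hmin⟩
  refine ⟨ε, hε, fun w hw => ?_⟩
  have : Nonempty (K.oneSkeleton.Walk v w) := hconn.preconnected v w
  refine le_ciInf fun p => ?_
  cases p with
  | nil => exact absurd rfl hw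
  | cons hadj p =>
    rw [degLength_cons]
    exact (h _ hadj).trans (le_add_of_nonneg_right (degLength_nonneg p))

/-- König's step: splitting off the first edge covers the ball by `{v}` and finitely many smaller
balls around neighbours, one of which must be infinite. -/
theorem exists_adj_infinite_pathBall {v : V} {s : ℝ} (h : (K.pathBall v s).Infinite) :
    ∃ w, K.oneSkeleton.Adj v w ∧ (K.pathBall w (s - K.edgeLength v w)).Infinite := by
  by_contra! hcon
  refine h (((finite_adj (K := K) v).biUnion (t := fun w => K.pathBall w (s - K.edgeLength v w))
    fun w hw => ?_).union (Set.finite_singleton v) |>.subset ?_)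
  · simpa using hcon w hw
  · rintro w ⟨p, hp⟩
    cases p with
    | nil => exact Or.inr rfl
    | cons hadj p =>
      rw [degLength_cons] at hp
      exact Or.inl (Set.mem_biUnion hadj ⟨p, by linarith⟩)

/-- Hopf–Rinow: an infinite ball yields, by iteration, an infinite path of total length at most `s`,
whose vertices converge by completeness. Vertices are isolated, so the path is eventually constant,
although consecutive vertices are adjacent and hence distinct. -/
theorem finite_pathBall [MetricSpace V] [CompleteSpace V] (hconn : K.oneSkeleton.Connected)
    (hd : ∀ v w : V, dist v w = K.degDist v w) (v : V) (s : ℝ) : (K.pathBall v s).Finite := by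
  by_contra hinf
  let B := {q : V × ℝ // (K.pathBall q.1 q.2).Infinite}
  choose next hadj hnext using fun q : B => exists_adj_infinite_pathBall q.2
  let q : ℕ → B := fun n => Nat.rec ⟨(v, s), hinf⟩
    (fun _ q => ⟨(next q, q.1.2 - K.edgeLength q.1.1 (next q)), hnext q⟩) n
  have hv : ∀ n, (q (n + 1)).1.1 = next (q n) := fun n => rfl
  have hs : ∀ n, (q (n + 1)).1.2 = (q n).1.2 - K.edgeLength (q n).1.1 (next (q n)) := fun n => rfl
  have hdist : ∀ n, dist (q n).1.1 (q (n + 1)).1.1 ≤ (q n).1.2 - (q (n + 1)).1.2 := by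
    intro n
    rw [hd, hs, hv, sub_sub_cancel]
    exact degDist_le_edgeLength (hadj _)
  have hsum : Summable fun n => dist (q n).1.1 (q (n + 1)).1.1 := by
    refine summable_of_sum_range_le (c := (q 0).1.2) (fun _ => dist_nonneg) fun n => ?_
    refine (Finset.sum_le_sum fun i _ => hdist i).trans ?_
    rw [Finset.sum_range_sub']
    -- The remaining radius never becomes negative, because a ball of negative radius is empty.
    linarith [nonneg_of_infinite_pathBall (q n).2]
  obtain ⟨x, hx⟩ := cauchySeq_tendsto_of_complete (cauchySeq_of_summable_dist hsum)
  obtain ⟨ε, hε, hiso⟩ := exists_pos_le_degDist hconn x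
  have hev : ∀ᶠ n in atTop, (q n).1.1 = x := by
    filter_upwards [hx.eventually (Metric.ball_mem_nhds x hε)] with n hn
    by_contra hne
    have h1 := hiso _ hne
    rw [← hd, dist_comm] at h1
    exact absurd (Metric.mem_ball.1 hn) (not_lt.2 h1)
  obtain ⟨N, hN⟩ := eventually_atTop.1 hev
  have h1 := hadj (q N)
  rw [← hv, hN N le_rfl, hN (N + 1) (Nat.le_succ N)] at h1
  exact h1.1 rfl

/-! ### Cutoff functions -/

/-- The cutoff is `χ σ = max_{v ∈ σ} (1 - d(v₀, v)/R)₊`. Its squared slope along an edge is at most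
`1/(R² max deg)`, which compensates the number of cofaces, so its energy is at most `2n/R²`. -/
theorem exists_cutoff [MetricSpace V] [CompleteSpace V] (δ : K.Coboundary)
    (hconn : K.oneSkeleton.Connected) (hdim : K.FiniteDimensional)
    (hd : ∀ v w : V, dist v w = K.degDist v w) (x : K.Simplex) {ε : ℝ} (hε : 0 < ε) :
    ∃ χ : K.Simplex → ℝ, (Function.support χ).Finite ∧ χ x = 1 ∧
      ∀ (z : K.Simplex) (F : Finset K.Simplex),
        ∑ y ∈ F, |δ.hodgeKernel z y| * (χ z - χ y) ^ 2 ≤ ε := by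
  -- For finite `V` the constant `1` is a cutoff. Otherwise the empty simplex is absent, which the
  -- vertex choices below rely on.
  by_cases hV : Finite V
  · have : Finite K.Simplex := Finite.of_injective (fun σ : K.Simplex => σ.1)
      fun a b h => Subtype.ext h
    exact ⟨fun _ => 1, Set.toFinite _, rfl, fun z F => by simpa using hε.le⟩
  have hne : ∀ σ : K.Simplex, σ.1.Nonempty := fun σ =>
    Finset.nonempty_iff_ne_empty.2 fun h0 => by
      rcases σ.2 with h | h
      · rw [h0] at h
        simpa using (K.isRelLowerSet_faces h).1
      · exact hV h.2
  obtain ⟨n, hn⟩ := card_faceFinset_le hdim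
  obtain ⟨v₀, hv₀⟩ := hne x
  -- Then `2n ≤ εR`, and `R ≥ 1` gives `2n/R² ≤ ε`.
  set R : ℝ := 2 * n / ε + 1 with hR
  have hR1 : 1 ≤ R := by rw [hR]; exact le_add_of_nonneg_left (by positivity)
  have hR0 : 0 < R := one_pos.trans_le hR1
  let f : V → NNReal := fun v => (1 - dist v₀ v / R).toNNReal
  have hf : ∀ v, (f v : ℝ) = max (1 - dist v₀ v / R) 0 := fun v => Real.coe_toNNReal' _
  have hf1 : ∀ v, f v ≤ 1 := fun v => by
    rw [← NNReal.coe_le_coe, hf]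
    exact max_le (sub_le_self _ (by positivity)) zero_le_one
  have hfv₀ : f v₀ = 1 := by
    rw [← NNReal.coe_inj, hf]
    simp
  have hlip : ∀ v w, K.oneSkeleton.Adj v w → |(f v : ℝ) - f w| ≤ K.edgeLength v w / R := by
    intro v w h
    rw [hf, hf]
    refine (abs_max_sub_max_le_abs _ _ _).trans ?_
    rw [sub_sub_sub_cancel_left, ← sub_div, abs_div, abs_of_pos hR0]
    refine div_le_div_of_nonneg_right ?_ hR0.le
    refine le_trans ?_ (degDist_le_edgeLength h)
    rw [← hd, dist_comm v₀ w, dist_comm v₀ v, dist_comm v w]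
    exact abs_dist_sub_le w v v₀
  have hM : (0 : ℝ) ≤ 1 / R ^ 2 := by positivity
  -- the key estimate for two vertices of a common simplex
  have key : ∀ (σ τ : K.Simplex) (v w : V), v ∈ σ.1 → w ∈ σ.1 → v ∈ τ.1 ∨ w ∈ τ.1 →
      ((f v : ℝ) - f w) ^ 2 * (cofaceFinset τ).card ≤ 1 / R ^ 2 := by
    intro σ τ v w hv hw hτ
    by_cases hvw : v = w
    · rw [hvw, sub_self]; simpa using hM
    have hadj := oneSkeleton_adj_of_mem hv hw hvw
    have h1 : ((f v : ℝ) - f w) ^ 2 ≤ (K.edgeLength v w / R) ^ 2 := by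
      rw [← sq_abs]
      exact pow_le_pow_left₀ (abs_nonneg _) (hlip v w hadj) 2
    have h2 : K.edgeLength v w ^ 2 * (cofaceFinset τ).card ≤ 1 := by
      rcases hτ with hτ | hτ
      · exact (mul_le_mul_of_nonneg_left (by exact_mod_cast card_cofaceFinset_le_deg hτ)
          (sq_nonneg _)).trans (edgeLength_sq_mul_deg_le v w)
      · rw [edgeLength_comm]
        exact (mul_le_mul_of_nonneg_left (by exact_mod_cast card_cofaceFinset_le_deg hτ)
          (sq_nonneg _)).trans (edgeLength_sq_mul_deg_le w v)
    calc ((f v : ℝ) - f w) ^ 2 * (cofaceFinset τ).card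
        ≤ (K.edgeLength v w / R) ^ 2 * (cofaceFinset τ).card :=
          mul_le_mul_of_nonneg_right h1 (Nat.cast_nonneg _)
      _ = K.edgeLength v w ^ 2 * (cofaceFinset τ).card / R ^ 2 := by rw [div_pow]; ring
      _ ≤ 1 / R ^ 2 := div_le_div_of_nonneg_right h2 (by positivity)
  refine ⟨fun σ => (σ.1.sup f : NNReal), ?_, ?_, fun z F => ?_⟩
  · refine ((finite_pathBall hconn hd v₀ R).biUnion fun v _ => finite_simplices_mem v).subset
      fun σ hσ => ?_
    obtain ⟨v, hv, hvs⟩ := Finset.exists_mem_eq_sup σ.1 (hne σ) f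
    rw [Function.mem_support, hvs, hf] at hσ
    refine Set.mem_biUnion (x := v) ?_ hv
    have hlt : dist v₀ v < R := by
      by_contra! hge
      exact hσ (max_eq_right (sub_nonpos.2 ((one_le_div hR0).2 hge)))
    rw [hd] at hlt
    have : Nonempty (K.oneSkeleton.Walk v₀ v) := hconn.preconnected v₀ v
    obtain ⟨p, hp⟩ := exists_lt_of_ciInf_lt hlt
    exact ⟨p, hp.le⟩
  · have h1 : x.1.sup f = 1 :=
      le_antisymm (Finset.sup_le fun v _ => hf1 v) (hfv₀ ▸ Finset.le_sup hv₀)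
    simp [h1]
  · refine (δ.sum_abs_hodgeKernel_mul_le hn (fun y => sq_nonneg _) hM ?_ ?_ F).trans ?_
    · intro σ y hz hy
      obtain ⟨a, ha⟩ := hne z
      obtain ⟨b, hb⟩ := hne y
      refine sup_sub_sup_sq_mul_le f (Nat.cast_nonneg _) hM (fun v hv => ⟨b, hb, ?_⟩)
        fun w hw => ⟨a, ha, ?_⟩
      · exact key σ z v b (hz.1 hv) (hy.1 hb) (Or.inl hv)
      · exact key σ z w a (hy.1 hw) (hz.1 ha) (Or.inr ha)
    -- Every vertex of `z` or `y` is compared with one vertex `a` of the common face `ρ`, whose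
    -- degree bounds the number of cofaces of `ρ`.
    · intro ρ y hz hy
      obtain ⟨a, ha⟩ := hne ρ
      refine sup_sub_sup_sq_mul_le f (Nat.cast_nonneg _) hM (fun v hv => ⟨a, hy.1 ha, ?_⟩)
        fun w hw => ⟨a, hz.1 ha, ?_⟩
      · exact key z ρ v a hv (hz.1 ha) (Or.inr ha)
      · exact key y ρ w a hw (hy.1 ha) (Or.inr ha)
    · rw [mul_one_div, div_le_iff₀ (by positivity)]
      have h1 : 2 * n ≤ ε * R := by
        rw [hR, mul_add, mul_div_cancel₀ _ hε.ne']
        linarith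
      have h2 : ε * R ≤ ε * R ^ 2 :=
        mul_le_mul_of_nonneg_left (le_self_pow₀ hR1 two_ne_zero) hε.le
      exact h1.trans h2

end AbstractSimplicialComplex

theorem mainTheorem10 {V : Type*} [Countable V] (K : AbstractSimplicialComplex V)
    [K.LocallyFinite] (hconn : K.oneSkeleton.Connected) (hdim : K.FiniteDimensional)
    (δ : K.Coboundary) (k : AbstractSimplicialComplex.Kind) (Q : δ.ClosedForm k) :
    (Q.laplacian.IsBoundedOp ↔ ∃ C : ℕ, ∀ v, K.deg v ≤ C) ∧
    K.finSupp ≤ Q.laplacian.domain ∧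
    ((∃ c : ℝ, ∀ τ : K.Simplex, c ≤ AbstractSimplicialComplex.formanCurvature τ) →
      Q.laplacianC.IsEssentiallySelfAdjoint) ∧
    (∀ M : MetricSpace V, (∀ v w, M.dist v w = K.degDist v w) →
      @CompleteSpace V M.toPseudoMetricSpace.toUniformSpace →
      Q.laplacianC.IsEssentiallySelfAdjoint) := by
  refine ⟨Q.isBoundedOp_iff hdim, Q.finSupp_le_domain, ?_, ?_⟩
  · rintro ⟨b, hb⟩
    -- This shift is positive and satisfies `b + c > 0` even when `b` is negative.
    refine Q.isEssentiallySelfAdjoint_of_forall (c := |b| + 1) (by positivity) fun u hu => ?_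
    exact AbstractSimplicialComplex.Coboundary.eq_zero_of_formanCurvature hb
      (by linarith [neg_abs_le b]) hu
  · intro M hd hM
    refine Q.isEssentiallySelfAdjoint_of_forall one_pos fun u hu => ?_
    exact AbstractSimplicialComplex.Coboundary.eq_zero_of_cutoff one_pos
      (fun x ε hε => AbstractSimplicialComplex.exists_cutoff δ hconn hdim hd x hε) hu
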